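/- For $\phi:\mathbb R^2\to\mathbb R$ continuous, let $\sigma$ denote projection measure on the surface $\Sigma_\phi=\{(y,|y|^2+\phi(y)):y\in\mathbb R^2\}\subset\mathbb R^3$, i.e. the image of Lebesgue measure on $\mathbb R^2$ under $y\mapsto(y,|y|^2+\phi(y))$. For complex-valued $f\in L^2(\mathbb R^2)$, let $f\sigma\ast f\sigma$ denote the convolution whose value on a bounded Borel set $B\subset\mathbb R^3$ is $\iint \mathbf 1_B\big(y+z,\ |y|^2+\phi(y)+|z|^2+\phi(z)\big)f(y)f(z)\,dy\,dz$; $\|f\sigma\ast f\sigma\|_{L^2(\mathbb R^3)}$ is the $L^2$ norm of its Lebesgue density ($\infty$ if there is none). Put $$\mathcal R_\phi:=\sup_{0\neq f\in L^2(\mathbb R^2)}\frac{\|f\sigma\ast f\sigma\|_{L^2(\mathbb R^3)}^{1/2}}{\|f\|_{L^2(\mathbb R^2)}}.$$ A sequence $\{f_n\}\subset L^2(\mathbb R^2)$ is *extremizing* if $\|f_n\|_{L^2}\le 1$ for all $n$ and $\|f_n\sigma\ast f_n\sigma\|_{L^2(\mathbb R^3)}\to\mathcal R_\phi^2$ as $n\to\infty$.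 It *concentrates at a point* $y_0\in\mathbb R^2$ (resp. *concentrates at infinity*) if for every $\varepsilon,\rho>0$ there is $N\in\mathbb N$ such that for every $n\ge N$ $$\int_{\{|y-y_0|\ge\rho\}}|f_n(y)|^2\,dy\le\varepsilon\|f_n\|_{L^2}^2\qquad\Big(\text{resp. }\int_{\{|y|\le\rho\}}|f_n(y)|^2\,dy\le\varepsilon\|f_n\|_{L^2}^2\Big).$$ **Theorem 1.4.** Let $\phi:\mathbb R^2\to\mathbb R$ be a nonnegative, twice continuously differentiable, strictly convex function whose Hessian matrix $H(\phi)$ satisfies at least one of the following conditions: (i) $H(\phi)(y_0)=0$ for some $y_0\in\mathbb R^2$; or (ii) there exists a sequence $\{y_n\}\subset\mathbb R^2$ with $|y_n|\to\infty$ such that $H(\phi)(y_n)\to0$ as $n\to\infty$. Then every extremizing sequence has a subsequence which either concentrates at some point $y_0\in\mathbb R^2$ satisfying $H(\phi)(y_0)=0$, or concentrates at infinity. -/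

import Mathlib

open MeasureTheory Filter Topology Set
open scoped ENNReal

noncomputable section

namespace PerturbedParaboloid

/-- The plane `ℝ²` with its Euclidean norm and Lebesgue measure. -/
abbrev Plane : Type := EuclideanSpace ℝ (Fin 2)

/-- The space `ℝ³ = ℝ² × ℝ`, with its product Lebesgue measure. -/
abbrev Space : Type := Plane × ℝ

/-- Complex-valued `L²(ℝ²)`. -/
abbrev L2Plane : Type := Lp ℂ 2 (volume : Measure Plane)

/-- The function `ψ = |·|² + φ`, whose graph is the surface `Σ_φ`. -/
def psi (φ : Plane → ℝ) (y : Plane) : ℝ := ‖y‖ ^ 2 + φ y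

/-- Projection measure `σ` on `Σ_φ`: the image of Lebesgue measure on `ℝ²` under
`y ↦ (y, |y|² + φ(y))`. -/
def projMeasure (φ : Plane → ℝ) : Measure Space :=
  Measure.map (fun y : Plane => (y, psi φ y)) volume

/-- The value of the convolution `fσ ∗ fσ` on a Borel set `B ⊆ ℝ³`:
`∬ 1_B(p + q) f(p) f(q) dσ(p) dσ(q)`, where `f` is viewed as a function on the surface
through the projection to `ℝ²`. -/
def selfConv (φ : Plane → ℝ) (f : Plane → ℂ) (B : Set Space) : ℂ :=
  ∫ p in {p : Space × Space | p.1 + p.2 ∈ B}, f p.1.1 * f p.2.1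
    ∂((projMeasure φ).prod (projMeasure φ))

/-- `F` is the density of `fσ ∗ fσ` with respect to Lebesgue measure on `ℝ³`. For `f ∈ L²` the
convolution is a complex Radon measure, hence is tested on bounded Borel sets. -/
def IsSelfConvDensity (φ : Plane → ℝ) (f : Plane → ℂ) (F : Space → ℂ) : Prop :=
  LocallyIntegrable F volume ∧
    ∀ B : Set Space, MeasurableSet B → Bornology.IsBounded B →
      selfConv φ f B = ∫ x in B, F x

/-- The norm `‖fσ ∗ fσ‖_{L²(ℝ³)}`: the `L²` norm of the density of `fσ ∗ fσ` (unique up to null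
sets), and `∞` if there is no density. -/
def selfConvNorm (φ : Plane → ℝ) (f : Plane → ℂ) : ℝ≥0∞ :=
  ⨅ (F : Space → ℂ) (_ : IsSelfConvDensity φ f F), eLpNorm F 2 volume

/-- The optimal constant
`R_φ = sup_{0 ≠ f ∈ L²} ‖fσ ∗ fσ‖_{L²(ℝ³)}^{1/2} / ‖f‖_{L²(ℝ²)}`. -/
def optConst (φ : Plane → ℝ) : ℝ≥0∞ :=
  ⨆ (f : L2Plane) (_ : f ≠ 0), selfConvNorm φ f ^ (1 / 2 : ℝ) / ‖f‖ₑ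

/-- Extremizing sequences for `‖fσ ∗ fσ‖_{L²(ℝ³)} ≤ R_φ² ‖f‖²_{L²(ℝ²)}`. -/
def IsExtremizingSeq (φ : Plane → ℝ) (f : ℕ → L2Plane) : Prop :=
  (∀ n, ‖f n‖ ≤ 1) ∧
    Tendsto (fun n => selfConvNorm φ (f n)) atTop (𝓝 (optConst φ ^ 2))

/-- The sequence `f` concentrates at the point `y₀`. -/
def ConcentratesAt (f : ℕ → L2Plane) (y₀ : Plane) : Prop :=
  ∀ ε > (0 : ℝ), ∀ ρ > (0 : ℝ), ∃ N : ℕ, ∀ n ≥ N,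
    ∫ y in {y : Plane | ρ ≤ ‖y - y₀‖}, ‖f n y‖ ^ 2 ≤ ε * ‖f n‖ ^ 2

/-- The sequence `f` concentrates at infinity. -/
def ConcentratesAtInfinity (f : ℕ → L2Plane) : Prop :=
  ∀ ε > (0 : ℝ), ∀ ρ > (0 : ℝ), ∃ N : ℕ, ∀ n ≥ N,
    ∫ y in {y : Plane | ‖y‖ ≤ ρ}, ‖f n y‖ ^ 2 ≤ ε * ‖f n‖ ^ 2

/-- The Hessian matrix `H(φ)(y)` of second-order partial derivatives. -/
def hessian (φ : Plane → ℝ) (y : Plane) : Matrix (Fin 2) (Fin 2) ℝ :=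
  Matrix.of fun i j =>
    fderiv ℝ (fderiv ℝ φ) y (EuclideanSpace.single i 1) (EuclideanSpace.single j 1)

end PerturbedParaboloid

end

/-! Consider T(y, z) = (y + z, ψ(y) + ψ(z)) from ℝ⁴ to ℝ³. For fixed y + z, every direction of y - z
meets each admissible level of the second component exactly once, so the fibres of T are closed
curves parametrized by that direction. Put any probability density P on directions, allowed to
depend on y + z. Then T carries the measure `jac` · P dy dz to Lebesgue measure on its image, and
Cauchy–Schwarz along the fibres gives ‖fσ ∗ fσ‖² ≤ ∬ (`jac` · P)⁻¹ |f(y)|² |f(z)|² dy dz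
(`selfConvNorm_sq_le`). Convexity gives `jac` ≥ 4, the value for the exact paraboloid, so the
uniform P = 1/(2π) bounds the left side by (π/2)‖f‖⁴.

The Hessian condition supplies the reverse bound R⁴ ≥ π/2 (`pi_div_two_le_optConst`). Near a point
where the Hessian is almost zero, `jac` is almost 4. Truncated exponentials of ψ minus its tangent
plane have tensor squares constant along the fibres, up to truncation, so they nearly saturate
Cauchy–Schwarz.

Hence along an extremizing sequence the weighted integral is at least π/2 - o(1) for every choice of
P, while ‖f_n‖ ≤ 1. Any set of pairs on which some weight lies definitely below π/2 is therefore
penalized (`eventually_mul_prod_real_lt`). Three choices of P carry the argument: - The uniform P.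
Strict convexity makes `jac` exceed 4 uniformly on bounded separated pairs, so two separated bounded
pieces cannot both keep mass. - A P with a share δ in a thin cone. Pairs with one point near y₀ and
the other far away have nearly prescribed direction and get tiny weight, while all other pairs lose
only a factor 1/(1 - δ). So mass cannot split between a bounded piece and infinity. - A P tilted
against a nonzero Hessian at y₀. Its weight is uniformly below π/2 near y₀, which excludes
concentration there. If mass persists in some ball, the first two facts and compactness give
concentration at a point, and the third makes the Hessian vanish there. Otherwise a subsequence
escapes to infinity. -/

namespace PerturbedParaboloid

/-! ### Convex functions on the plane -/

/-- The monotonicity gap `⟨∇φ(y) - ∇φ(z), y - z⟩` of the gradient. -/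
noncomputable def gradGap (φ : Plane → ℝ) (y z : Plane) : ℝ :=
  fderiv ℝ φ y (y - z) - fderiv ℝ φ z (y - z)

lemma tangent_le {φ : Plane → ℝ} (hd : Differentiable ℝ φ) (hc : ConvexOn ℝ univ φ)
    (y z : Plane) : φ z + fderiv ℝ φ z (y - z) ≤ φ y := by
  set h : ℝ → ℝ := fun t => φ (z + t • (y - z)) with hh
  have hconv : ConvexOn ℝ univ h := by
    have h1 : h = φ ∘ (AffineMap.lineMap z y : ℝ →ᵃ[ℝ] Plane) := by
      ext t
      simp [hh, AffineMap.lineMap_apply, add_comm]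
    rw [h1]
    simpa using hc.comp_affineMap (AffineMap.lineMap z y : ℝ →ᵃ[ℝ] Plane)
  have hder : HasDerivAt h (fderiv ℝ φ z (y - z)) 0 := by
    have h1 : HasDerivAt (fun t : ℝ => z + t • (y - z)) (y - z) 0 := by
      simpa using ((hasDerivAt_id (0 : ℝ)).smul_const (y - z)).const_add z
    have h2 : HasFDerivAt φ (fderiv ℝ φ z) (z + (0 : ℝ) • (y - z)) := by
      simpa using (hd z).hasFDerivAt
    exact h2.comp_hasDerivAt 0 h1
  have := hconv.le_slope_of_hasDerivAt (mem_univ 0) (mem_univ 1) one_pos hder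
  simp [slope_def_field, hh, -map_sub] at this
  linarith

lemma tangent_lt {φ : Plane → ℝ} (hd : Differentiable ℝ φ) (hc : StrictConvexOn ℝ univ φ)
    {y z : Plane} (hyz : y ≠ z) : φ z + fderiv ℝ φ z (y - z) < φ y := by
  have h1 := tangent_le hd hc.convexOn ((1 / 2 : ℝ) • y + (1 / 2 : ℝ) • z) z
  have h2 := hc.2 (mem_univ y) (mem_univ z) hyz (by norm_num : (0 : ℝ) < 1 / 2)
    (by norm_num : (0 : ℝ) < 1 / 2) (by norm_num)
  have h3 : (1 / 2 : ℝ) • y + (1 / 2 : ℝ) • z - z = (1 / 2 : ℝ) • (y - z) := by module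
  rw [h3, map_smul] at h1
  simp only [smul_eq_mul] at h1 h2
  linarith

lemma gradGap_nonneg {φ : Plane → ℝ} (hd : Differentiable ℝ φ) (hc : ConvexOn ℝ univ φ)
    (y z : Plane) : 0 ≤ gradGap φ y z := by
  have h1 := tangent_le hd hc y z
  have h2 := tangent_le hd hc z y
  rw [← neg_sub y z, map_neg] at h2
  unfold gradGap
  linarith

lemma gradGap_pos {φ : Plane → ℝ} (hd : Differentiable ℝ φ) (hc : StrictConvexOn ℝ univ φ)
    {y z : Plane} (hyz : y ≠ z) : 0 < gradGap φ y z := by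
  have h1 := tangent_lt hd hc hyz
  have h2 := tangent_lt hd hc hyz.symm
  rw [← neg_sub y z, map_neg] at h2
  unfold gradGap
  linarith

lemma continuous_gradGap {φ : Plane → ℝ} (h : ContDiff ℝ 1 φ) :
    Continuous fun p : Plane × Plane => gradGap φ p.1 p.2 := by
  have := h.continuous_fderiv one_ne_zero
  unfold gradGap
  fun_prop

/-- The Jacobian of `(y, z) ↦ (y + z, ψ(y) + ψ(z))` in polar coordinates for `(y - z) / 2`,
relative to the planar area element. -/
noncomputable def jac (φ : Plane → ℝ) (y z : Plane) : ℝ := 4 + 2 * gradGap φ y z / ‖y - z‖ ^ 2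

lemma four_le_jac {φ : Plane → ℝ} (hd : Differentiable ℝ φ) (hc : ConvexOn ℝ univ φ)
    (y z : Plane) : 4 ≤ jac φ y z := by
  have := gradGap_nonneg hd hc y z
  unfold jac
  have : 0 ≤ 2 * gradGap φ y z / ‖y - z‖ ^ 2 := by positivity
  linarith

lemma measurable_jac {φ : Plane → ℝ} (h : ContDiff ℝ 1 φ) :
    Measurable fun p : Plane × Plane => jac φ p.1 p.2 := by
  have := (continuous_gradGap h).measurable
  unfold jac
  fun_prop

/-- The map `(y, z) ↦ (y + z, ψ(y) + ψ(z))`. -/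
noncomputable def sumMap (φ : Plane → ℝ) (p : Plane × Plane) : Space :=
  (p.1 + p.2, psi φ p.1 + psi φ p.2)

lemma continuous_psi {φ : Plane → ℝ} (h : Continuous φ) : Continuous (psi φ) := by
  unfold psi
  fun_prop

lemma continuous_sumMap {φ : Plane → ℝ} (h : Continuous φ) : Continuous (sumMap φ) := by
  have := continuous_psi h
  unfold sumMap
  fun_prop

/-- The interior of the support of `σ ∗ σ`. -/
def sumRegion (φ : Plane → ℝ) : Set Space := {p | 2 * psi φ ((1 / 2 : ℝ) • p.1) < p.2}

lemma isOpen_sumRegion {φ : Plane → ℝ} (h : Continuous φ) : IsOpen (sumRegion φ) := by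
  have := continuous_psi h
  exact isOpen_lt (by fun_prop) (by fun_prop)

/-! ### Polar coordinates -/

/-- The unit vector with angle `θ`. -/
noncomputable def dir (θ : ℝ) : Plane := !₂[Real.cos θ, Real.sin θ]

lemma norm_dir (θ : ℝ) : ‖dir θ‖ = 1 := by
  simp [dir, EuclideanSpace.norm_eq, Fin.sum_univ_two]

lemma continuous_dir : Continuous dir := by
  unfold dir
  refine (PiLp.continuous_toLp 2 (fun _ : Fin 2 => ℝ)).comp ?_
  refine continuous_pi fun i => ?_
  fin_cases i
  · exact Real.continuous_cos
  · exact Real.continuous_sin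

lemma lintegral_polar {h : Plane → ℝ≥0∞} (hm : Measurable h) :
    ∫⁻ w, h w = ∫⁻ θ in Ioo (-Real.pi) Real.pi, ∫⁻ r in Ioi (0 : ℝ),
      ENNReal.ofReal r * h (r • dir θ) := by
  have h1 : MeasurePreserving (fun p : ℝ × ℝ => (!₂[p.1, p.2] : Plane)) volume volume :=
    ((EuclideanSpace.volume_preserving_symm_measurableEquiv_toLp (Fin 2)).symm _).comp
      ((volume_preserving_finTwoArrow ℝ).symm _)
  rw [← h1.lintegral_comp hm, ← lintegral_comp_polarCoord_symm]
  have h2 : polarCoord.target = Ioi (0 : ℝ) ×ˢ Ioo (-Real.pi) Real.pi := rfl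
  have h3 : ∀ p : ℝ × ℝ, (!₂[(polarCoord.symm p).1, (polarCoord.symm p).2] : Plane)
      = p.1 • dir p.2 := by
    intro p
    ext i
    fin_cases i <;> simp [dir]
  simp only [h3, smul_eq_mul]
  have := continuous_dir
  rw [h2, Measure.volume_eq_prod, ← Measure.prod_restrict, lintegral_prod_symm']
  fun_prop

lemma norm_sq_add_sub (c w : Plane) : ‖c + w‖ ^ 2 + ‖c - w‖ ^ 2 = 2 * ‖c‖ ^ 2 + 2 * ‖w‖ ^ 2 := by
  have := parallelogram_law_with_norm ℝ c w
  nlinarith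

lemma psi_add_psi (φ : Plane → ℝ) (c w : Plane) :
    psi φ (c + w) + psi φ (c - w) = 2 * ‖c‖ ^ 2 + 2 * ‖w‖ ^ 2 + (φ (c + w) + φ (c - w)) := by
  have := norm_sq_add_sub c w
  unfold psi
  linarith

lemma two_psi_add_le {φ : Plane → ℝ} (hc : ConvexOn ℝ univ φ) (c w : Plane) :
    2 * psi φ c + 2 * ‖w‖ ^ 2 ≤ psi φ (c + w) + psi φ (c - w) := by
  rw [psi_add_psi]
  have h2 := hc.2 (mem_univ (c + w)) (mem_univ (c - w)) (by norm_num : (0 : ℝ) ≤ 1 / 2)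
    (by norm_num : (0 : ℝ) ≤ 1 / 2) (by norm_num)
  have h3 : (1 / 2 : ℝ) • (c + w) + (1 / 2 : ℝ) • (c - w) = c := by module
  rw [h3] at h2
  simp only [smul_eq_mul] at h2
  unfold psi
  linarith

/-- The quadratic part contributes 4r. The difference of the directional derivatives of φ is the
gradient gap divided by 2r, because y - z = 2rω. The factor r is split off to match the polar area
element. -/
lemma hasDerivAt_psi_add_psi {φ : Plane → ℝ} (hd : Differentiable ℝ φ) (c : Plane) {ω : Plane}
    (hω : ‖ω‖ = 1) {r : ℝ} (hr : 0 < r) :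
    HasDerivAt (fun r : ℝ => psi φ (c + r • ω) + psi φ (c - r • ω))
      (r * jac φ (c + r • ω) (c - r • ω)) r := by
  have h1 : (fun r : ℝ => psi φ (c + r • ω) + psi φ (c - r • ω)) =
      fun r : ℝ => 2 * ‖c‖ ^ 2 + 2 * r ^ 2 + (φ (c + r • ω) + φ (c - r • ω)) := by
    ext r
    rw [psi_add_psi, norm_smul, hω, mul_one, Real.norm_eq_abs, sq_abs]
  have hl : HasDerivAt (fun t : ℝ => t • ω) ω r := by
    simpa using (hasDerivAt_id r).smul_const ω
  have h2 : HasDerivAt (fun t : ℝ => φ (c + t • ω)) (fderiv ℝ φ (c + r • ω) ω) r :=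
    (hd _).hasFDerivAt.comp_hasDerivAt r (hl.const_add c)
  have h3 : HasDerivAt (fun t : ℝ => φ (c - t • ω)) (fderiv ℝ φ (c - r • ω) (-ω)) r :=
    (hd _).hasFDerivAt.comp_hasDerivAt r (hl.const_sub c)
  have h4 : HasDerivAt (fun t : ℝ => 2 * ‖c‖ ^ 2 + 2 * t ^ 2) (4 * r) r :=
    (((hasDerivAt_pow 2 r).const_mul 2).const_add (2 * ‖c‖ ^ 2)).congr_deriv
      (by norm_num; ring)
  rw [h1]
  refine (h4.add (h2.add h3)).congr_deriv ?_
  have h5 : c + r • ω - (c - r • ω) = (2 * r) • ω := by module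
  unfold jac gradGap
  rw [h5, norm_smul, hω, map_smul, map_smul, map_neg, mul_one, Real.norm_eq_abs, sq_abs]
  simp only [smul_eq_mul]
  field_simp
  ring

lemma image_psi_add_psi {φ : Plane → ℝ} (hcont : Continuous φ) (hc : ConvexOn ℝ univ φ)
    (c : Plane) {ω : Plane} (hω : ‖ω‖ = 1) :
    (fun r : ℝ => psi φ (c + r • ω) + psi φ (c - r • ω)) '' Ioi 0 = Ioi (2 * psi φ c) := by
  have hpsi := continuous_psi hcont
  have key : ∀ r : ℝ, 2 * psi φ c + 2 * r ^ 2 ≤ psi φ (c + r • ω) + psi φ (c - r • ω) := by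
    intro r
    have := two_psi_add_le hc c (r • ω)
    rwa [norm_smul, hω, mul_one, Real.norm_eq_abs, sq_abs] at this
  apply Subset.antisymm
  · rintro _ ⟨r, hr, rfl⟩
    have := key r
    have hr' : 0 < r ^ 2 := pow_pos hr 2
    simp only [mem_Ioi]
    linarith
  · intro τ hτ
    simp only [mem_Ioi] at hτ
    -- Since R ≥ 1, the quadratic growth in `key` already puts the value at R above τ.
    set R : ℝ := τ - 2 * psi φ c + 1
    have hR : 1 ≤ R := by simp only [R]; linarith
    have hcts : ContinuousOn (fun r : ℝ => psi φ (c + r • ω) + psi φ (c - r • ω)) (Icc 0 R) := by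
      fun_prop
    have := intermediate_value_Icc (by linarith : (0 : ℝ) ≤ R) hcts
    have hmem : τ ∈ Icc (psi φ (c + (0 : ℝ) • ω) + psi φ (c - (0 : ℝ) • ω))
        (psi φ (c + R • ω) + psi φ (c - R • ω)) := by
      constructor
      · simp only [zero_smul, add_zero, sub_zero]
        linarith
      · have := key R
        simp only [R] at this ⊢
        nlinarith
    obtain ⟨r, hr, hr'⟩ := this hmem
    refine ⟨r, lt_of_le_of_ne hr.1 ?_, hr'⟩
    rintro rfl
    simp only [zero_smul, add_zero, sub_zero] at hr'
    linarith

lemma lintegral_radial {φ : Plane → ℝ} (hd : Differentiable ℝ φ) (hc : ConvexOn ℝ univ φ)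
    (c : Plane) {ω : Plane} (hω : ‖ω‖ = 1) (Φ : ℝ → ℝ≥0∞) :
    ∫⁻ r in Ioi (0 : ℝ), ENNReal.ofReal (r * jac φ (c + r • ω) (c - r • ω)) *
      Φ (psi φ (c + r • ω) + psi φ (c - r • ω)) = ∫⁻ τ in Ioi (2 * psi φ c), Φ τ := by
  have hmono : MonotoneOn (fun r : ℝ => psi φ (c + r • ω) + psi φ (c - r • ω)) (Ioi 0) := by
    refine monotoneOn_of_deriv_nonneg (convex_Ioi 0) ?_ ?_ ?_
    · intro r hr
      exact (hasDerivAt_psi_add_psi hd c hω hr).continuousAt.continuousWithinAt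
    · intro r hr
      rw [interior_Ioi] at hr
      exact (hasDerivAt_psi_add_psi hd c hω hr).differentiableAt.differentiableWithinAt
    · intro r hr
      rw [interior_Ioi] at hr
      rw [(hasDerivAt_psi_add_psi hd c hω hr).deriv]
      have := four_le_jac hd hc (c + r • ω) (c - r • ω)
      exact mul_nonneg (le_of_lt hr) (by linarith)
  rw [← image_psi_add_psi hd.continuous hc c hω]
  exact (lintegral_image_eq_lintegral_deriv_mul_of_monotoneOn measurableSet_Ioi
    (fun r hr => (hasDerivAt_psi_add_psi hd c hω hr).hasDerivWithinAt) hmono Φ).symm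

/-! ### The change of variables -/

/-- A family of probability densities on the unit circle, extended to be homogeneous of degree
zero, which is bounded below. -/
structure IsAngularDensity (P : Plane → Plane → ℝ) : Prop where
  measurable : Measurable (Function.uncurry P)
  bddBelow : ∃ c > 0, ∀ ξ w, c ≤ P ξ w
  smul : ∀ ξ w, ∀ r > (0 : ℝ), P ξ (r • w) = P ξ w
  lintegral_eq_one : ∀ ξ, ∫⁻ θ in Ioo (-Real.pi) Real.pi, ENNReal.ofReal (P ξ (dir θ)) = 1

lemma IsAngularDensity.pos {P : Plane → Plane → ℝ} (hP : IsAngularDensity P) (ξ w : Plane) :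
    0 < P ξ w := by
  obtain ⟨c, hc, h⟩ := hP.bddBelow
  exact hc.trans_le (h ξ w)

lemma lintegral_prod_eq_sum_diff {H : Plane × Plane → ℝ≥0∞} (hH : Measurable H) :
    ∫⁻ p, H p = ∫⁻ ξ : Plane, ∫⁻ w : Plane, H ((1 / 2 : ℝ) • ξ + w, (1 / 2 : ℝ) • ξ - w) := by
  rw [Measure.volume_eq_prod, lintegral_prod_symm' _ hH]
  calc ∫⁻ z : Plane, ∫⁻ y : Plane, H (y, z)
      = ∫⁻ z : Plane, ∫⁻ ξ : Plane, H (ξ - z, z) := by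
        refine lintegral_congr fun z => ?_
        exact (lintegral_sub_right_eq_self (fun y => H (y, z)) z).symm
    _ = ∫⁻ ξ : Plane, ∫⁻ z : Plane, H (ξ - z, z) := by
        refine lintegral_lintegral_swap (Measurable.aemeasurable ?_)
        simp only [Function.uncurry_def]
        fun_prop
    _ = _ := by
        refine lintegral_congr fun ξ => ?_
        rw [← lintegral_sub_left_eq_self _ ((1 / 2 : ℝ) • ξ)]
        refine lintegral_congr fun w => ?_
        congr 2
        module

/-- The density of the measure on pairs which `sumMap` sends to Lebesgue measure. -/
noncomputable def pairDensity (φ : Plane → ℝ) (P : Plane → Plane → ℝ) (p : Plane × Plane) : ℝ :=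
  jac φ p.1 p.2 * P (p.1 + p.2) (p.1 - p.2)

lemma measurable_pairDensity {φ : Plane → ℝ} (h : ContDiff ℝ 1 φ) {P : Plane → Plane → ℝ}
    (hP : IsAngularDensity P) : Measurable (pairDensity φ P) := by
  have h1 := measurable_jac h
  have h2 : Measurable fun p : Plane × Plane => P (p.1 + p.2) (p.1 - p.2) :=
    hP.measurable.comp (f := fun p : Plane × Plane => (p.1 + p.2, p.1 - p.2)) (by fun_prop)
  exact h1.mul h2

lemma pairDensity_pos {φ : Plane → ℝ} (hd : Differentiable ℝ φ) (hc : ConvexOn ℝ univ φ)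
    {P : Plane → Plane → ℝ} (hP : IsAngularDensity P) (p : Plane × Plane) :
    0 < pairDensity φ P p :=
  mul_pos (by linarith [four_le_jac hd hc p.1 p.2]) (hP.pos _ _)

/-- For fixed ξ = y + z, the radial substitution turns the integral along each ray into the same
integral over τ, whatever the angle. The angular factor then integrates to 1, which is why P is
arbitrary. -/
theorem lintegral_comp_sumMap {φ : Plane → ℝ} (h : ContDiff ℝ 1 φ) (hc : ConvexOn ℝ univ φ)
    {P : Plane → Plane → ℝ} (hP : IsAngularDensity P) {Φ : Space → ℝ≥0∞} (hΦ : Measurable Φ) :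
    ∫⁻ p, ENNReal.ofReal (pairDensity φ P p) * Φ (sumMap φ p) = ∫⁻ x in sumRegion φ, Φ x := by
  have hd : Differentiable ℝ φ := h.differentiable one_ne_zero
  have hmd := measurable_pairDensity h hP
  have hms := (continuous_sumMap h.continuous).measurable
  have hPm : ∀ ξ, Measurable fun θ => ENNReal.ofReal (P ξ (dir θ)) := fun ξ =>
    (hP.measurable.comp (measurable_const.prodMk continuous_dir.measurable)).ennreal_ofReal
  have hreg := (isOpen_sumRegion h.continuous).measurableSet
  rw [lintegral_prod_eq_sum_diff (by fun_prop), ← lintegral_indicator hreg,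
    Measure.volume_eq_prod, lintegral_prod _ ((hΦ.indicator hreg).aemeasurable)]
  refine lintegral_congr fun ξ => ?_
  rw [lintegral_polar (by fun_prop)]
  have hsum : (1 / 2 : ℝ) • ξ + (1 / 2 : ℝ) • ξ = ξ := by module
  have inner : ∀ θ, ∫⁻ r in Ioi (0 : ℝ), ENNReal.ofReal r *
      (ENNReal.ofReal (pairDensity φ P ((1 / 2 : ℝ) • ξ + r • dir θ, (1 / 2 : ℝ) • ξ - r • dir θ)) *
        Φ (sumMap φ ((1 / 2 : ℝ) • ξ + r • dir θ, (1 / 2 : ℝ) • ξ - r • dir θ))) =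
      ENNReal.ofReal (P ξ (dir θ)) *
        ∫⁻ τ in Ioi (2 * psi φ ((1 / 2 : ℝ) • ξ)), Φ (ξ, τ) := by
    intro θ
    rw [← lintegral_radial hd hc _ (norm_dir θ) (fun τ => Φ (ξ, τ)),
      ← lintegral_const_mul' _ _ ENNReal.ofReal_ne_top]
    refine setLIntegral_congr_fun measurableSet_Ioi fun r hr => ?_
    have hr : 0 < r := hr
    have e1 : (1 / 2 : ℝ) • ξ + r • dir θ + ((1 / 2 : ℝ) • ξ - r • dir θ) = ξ := by module
    have e2 : (1 / 2 : ℝ) • ξ + r • dir θ - ((1 / 2 : ℝ) • ξ - r • dir θ) = (2 * r) • dir θ := by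
      module
    simp only [pairDensity, sumMap, e1, e2, hP.smul ξ _ (2 * r) (by linarith)]
    rw [← mul_assoc, ← mul_assoc, ← ENNReal.ofReal_mul hr.le,
      ← ENNReal.ofReal_mul (hP.pos _ _).le]
    congr 2
    ring
  simp only [inner]
  rw [lintegral_mul_const _ (hPm ξ), hP.lintegral_eq_one, one_mul, ← lintegral_indicator measurableSet_Ioi]
  rfl

/-! ### The weighted bilinear estimate -/

lemma selfConv_eq {φ : Plane → ℝ} (hφ : Continuous φ) {f : Plane → ℂ} (hf : Measurable f)
    {B : Set Space} (hB : MeasurableSet B) :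
    selfConv φ f B = ∫ p in sumMap φ ⁻¹' B, f p.1 * f p.2 := by
  have hγ : Measurable fun y : Plane => (y, psi φ y) :=
    measurable_id.prodMk (continuous_psi hφ).measurable
  have hadd : Measurable fun p : Space × Space => p.1 + p.2 := by fun_prop
  have hprod : (projMeasure φ).prod (projMeasure φ) =
      Measure.map (Prod.map (fun y : Plane => (y, psi φ y)) fun y => (y, psi φ y))
        (volume : Measure (Plane × Plane)) := by
    rw [projMeasure, Measure.map_prod_map _ _ hγ hγ]
    rfl
  have hset : MeasurableSet {p : Space × Space | p.1 + p.2 ∈ B} := hadd hB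
  unfold selfConv
  rw [hprod, setIntegral_map hset (Measurable.aestronglyMeasurable (by fun_prop))
    (hγ.prodMap hγ).aemeasurable]
  rfl

/-- The measure on pairs with density `pairDensity`. -/
noncomputable def pairMeasure (φ : Plane → ℝ) (P : Plane → Plane → ℝ) : Measure (Plane × Plane) :=
  volume.withDensity fun p => ((pairDensity φ P p).toNNReal : ℝ≥0∞)

lemma measurePreserving_sumMap {φ : Plane → ℝ} (h : ContDiff ℝ 1 φ) (hc : ConvexOn ℝ univ φ)
    {P : Plane → Plane → ℝ} (hP : IsAngularDensity P) :
    MeasurePreserving (sumMap φ) (pairMeasure φ P) (volume.restrict (sumRegion φ)) := by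
  have hms := (continuous_sumMap h.continuous).measurable
  have hmd := measurable_pairDensity h hP
  refine ⟨hms, ?_⟩
  ext B hB
  rw [Measure.map_apply hms hB, pairMeasure, withDensity_apply _ (hms hB),
    ← lintegral_indicator_one hB,
    ← lintegral_comp_sumMap h hc hP (measurable_one.indicator hB), ← lintegral_indicator (hms hB)]
  refine lintegral_congr fun p => ?_
  by_cases hp : sumMap φ p ∈ B
  · simp [indicator_of_mem, hp, mem_preimage, ENNReal.ofReal]
  · simp [hp]

lemma lintegral_prod_sq {f : Plane → ℂ} (hf : Measurable f) :
    ∫⁻ p : Plane × Plane, (‖f p.1‖ₑ * ‖f p.2‖ₑ) ^ 2 = eLpNorm f 2 volume ^ 4 := by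
  have h1 : eLpNorm f 2 volume ^ 2 = ∫⁻ y, ‖f y‖ₑ ^ 2 := by
    have := eLpNorm_nnreal_pow_eq_lintegral (f := f) (p := 2) (μ := volume) two_ne_zero
    simpa using this
  simp only [mul_pow]
  rw [Measure.volume_eq_prod, lintegral_prod_mul (f := fun y => ‖f y‖ₑ ^ 2) (g := fun y => ‖f y‖ₑ ^ 2)
    (by fun_prop) (by fun_prop), ← h1]
  ring

/-- The convolution is the push-forward under `sumMap` of k = f⊗f / `pairDensity` against
`pairMeasure`. Its density is the fibre average of k, and averaging contracts L². As the norm is an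
infimum over densities, exhibiting one suffices. -/
theorem selfConvNorm_sq_le {φ : Plane → ℝ} (h : ContDiff ℝ 1 φ) (hc : ConvexOn ℝ univ φ)
    {P : Plane → Plane → ℝ} (hP : IsAngularDensity P) {f : Plane → ℂ} (hf : Measurable f)
    (hf2 : MemLp f 2 volume) :
    selfConvNorm φ f ^ 2 ≤
      ∫⁻ p : Plane × Plane, ENNReal.ofReal (pairDensity φ P p)⁻¹ * (‖f p.1‖ₑ * ‖f p.2‖ₑ) ^ 2 := by
  have hd : Differentiable ℝ φ := h.differentiable one_ne_zero
  have hms := (continuous_sumMap h.continuous).measurable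
  have hmd := measurable_pairDensity h hP
  have hT := measurePreserving_sumMap h hc hP
  have hpos := pairDensity_pos hd hc hP
  obtain ⟨c, hc0, hcP⟩ := hP.bddBelow
  set d : Plane × Plane → NNReal := fun p => (pairDensity φ P p).toNNReal with hd_def
  have hdm : Measurable d := hmd.real_toNNReal
  have hdpos : ∀ p, 0 < d p := fun p => Real.toNNReal_pos.2 (hpos p)
  set k : Plane × Plane → ℂ := fun p => (d p)⁻¹ • (f p.1 * f p.2) with hk_def
  have hkm : Measurable k := hdm.inv.smul (by fun_prop)
  have hk_norm : eLpNorm k 2 (pairMeasure φ P) ^ 2 = ∫⁻ p : Plane × Plane,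
      ENNReal.ofReal (pairDensity φ P p)⁻¹ * (‖f p.1‖ₑ * ‖f p.2‖ₑ) ^ 2 := by
    have h1 := eLpNorm_nnreal_pow_eq_lintegral (f := k) (p := 2) (μ := pairMeasure φ P) two_ne_zero
    have h2 : eLpNorm k 2 (pairMeasure φ P) ^ 2 = ∫⁻ p, ‖k p‖ₑ ^ 2 ∂(pairMeasure φ P) := by
      simpa using h1
    rw [h2, pairMeasure, lintegral_withDensity_eq_lintegral_mul _ (by fun_prop) (by fun_prop)]
    refine lintegral_congr fun p => ?_
    have e1 : ENNReal.ofReal (pairDensity φ P p)⁻¹ = ((d p)⁻¹ : NNReal) := by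
      rw [ENNReal.ofReal, Real.toNNReal_inv]
    have e2 : ‖k p‖ₑ = ((d p)⁻¹ : NNReal) * (‖f p.1‖ₑ * ‖f p.2‖ₑ) := by
      simp only [hk_def]
      rw [NNReal.smul_def, enorm_smul, enorm_mul, Real.enorm_of_nonneg (NNReal.coe_nonneg _),
        ENNReal.ofReal_coe_nnreal]
    have e3 : (d p : ℝ≥0∞) * ((d p)⁻¹ : NNReal) = 1 := by
      rw [← ENNReal.coe_mul, mul_inv_cancel₀ (hdpos p).ne', ENNReal.coe_one]
    simp only [Pi.mul_apply]
    rw [e1, e2, mul_pow, pow_two ((((d p)⁻¹ : NNReal) : ℝ≥0∞)), mul_assoc, ← mul_assoc, e3, one_mul]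
  have hk2 : MemLp k 2 (pairMeasure φ P) := by
    refine ⟨hkm.aestronglyMeasurable, ?_⟩
    have h1 : eLpNorm k 2 (pairMeasure φ P) ^ 2 < ∞ := by
      rw [hk_norm]
      -- The lower bound on P is needed here: it bounds the weight, so that k lies in L².
      calc _ ≤ ∫⁻ p : Plane × Plane, ENNReal.ofReal (4 * c)⁻¹ * (‖f p.1‖ₑ * ‖f p.2‖ₑ) ^ 2 := by
            refine lintegral_mono fun p => ?_
            gcongr
            exact mul_le_mul (four_le_jac hd hc _ _) (hcP _ _) hc0.le
              (by linarith [four_le_jac hd hc p.1 p.2])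
        _ < ∞ := by
            rw [lintegral_const_mul' _ _ ENNReal.ofReal_ne_top, lintegral_prod_sq hf]
            exact ENNReal.mul_lt_top ENNReal.ofReal_lt_top (ENNReal.pow_lt_top hf2.2)
    by_contra hcon
    rw [not_lt, top_le_iff] at hcon
    simp [hcon] at h1
  set U := Lp.compMeasurePreservingₗᵢ ℂ (p := 2) (E := ℂ) (sumMap φ) hT
  -- The adjoint of the isometry g ↦ g ∘ T is averaging over fibres, so no disintegration of
  -- measures is required. Its norm is at most 1, which encodes Cauchy–Schwarz.
  set F := (ContinuousLinearMap.adjoint U.toContinuousLinearMap) (hk2.toLp k) with hF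
  have hF_norm : ‖F‖ ≤ ‖hk2.toLp k‖ := by
    refine (ContinuousLinearMap.le_opNorm _ _).trans ?_
    rw [LinearIsometryEquiv.norm_map]
    exact mul_le_of_le_one_left (norm_nonneg _) (LinearIsometry.norm_toContinuousLinearMap_le _)
  have hreg := (isOpen_sumRegion h.continuous).measurableSet
  have hF0_norm : eLpNorm ((sumRegion φ).indicator F) 2 volume = ‖F‖ₑ := by
    rw [eLpNorm_indicator_eq_eLpNorm_restrict hreg, Lp.enorm_def]
  have hF0_mem : MemLp ((sumRegion φ).indicator F) 2 volume := by
    rw [memLp_indicator_iff_restrict hreg]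
    exact Lp.memLp F
  have hdens : IsSelfConvDensity φ f ((sumRegion φ).indicator F) := by
    refine ⟨hF0_mem.locallyIntegrable one_le_two, fun B hB hBb => ?_⟩
    have hBfin : (volume.restrict (sumRegion φ)) B ≠ ∞ :=
      ((Measure.restrict_apply_le _ _).trans_lt hBb.measure_lt_top).ne
    rw [setIntegral_indicator hreg, ← Measure.restrict_restrict hB,
      ← L2.inner_indicatorConstLp_one (𝕜 := ℂ) hB hBfin F, hF,
      ContinuousLinearMap.adjoint_inner_right]
    have hU : U.toContinuousLinearMap (indicatorConstLp 2 hB hBfin (1 : ℂ)) =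
        indicatorConstLp 2 (hT.measurable hB) (by rwa [hT.measure_preimage hB.nullMeasurableSet])
          (1 : ℂ) := Lp.indicatorConstLp_compMeasurePreserving hB hBfin 1 hT
    have hk_ae : ∫ p in sumMap φ ⁻¹' B, (hk2.toLp k) p ∂(pairMeasure φ P) =
        ∫ p in sumMap φ ⁻¹' B, k p ∂(pairMeasure φ P) :=
      setIntegral_congr_ae (hms hB) (hk2.coeFn_toLp.mono fun p hp _ => hp)
    rw [hU, L2.inner_indicatorConstLp_one, selfConv_eq h.continuous hf hB, hk_ae, pairMeasure,
      setIntegral_withDensity_eq_setIntegral_smul hdm _ (hms hB)]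
    refine setIntegral_congr_fun (hms hB) fun p _ => ?_
    simp only [hk_def]
    rw [smul_smul, mul_inv_cancel₀ (hdpos p).ne', one_smul]
  calc selfConvNorm φ f ^ 2 ≤ (‖F‖ₑ) ^ 2 := by
        gcongr
        rw [← hF0_norm]
        exact iInf₂_le _ hdens
    _ ≤ (‖hk2.toLp k‖ₑ) ^ 2 := by
        gcongr
        exact enorm_le_iff_norm_le.2 hF_norm
    _ = _ := by rw [Lp.enorm_toLp, hk_norm]

/-! ### The lower bound for the optimal constant -/

lemma isAngularDensity_const : IsAngularDensity fun _ _ => (2 * Real.pi)⁻¹ where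
  measurable := measurable_const
  bddBelow := ⟨(2 * Real.pi)⁻¹, by positivity, fun _ _ => le_rfl⟩
  smul _ _ _ _ := rfl
  lintegral_eq_one _ := by
    rw [setLIntegral_const, Real.volume_Ioo, ← ENNReal.ofReal_mul (by positivity)]
    have : (2 * Real.pi)⁻¹ * (Real.pi - -Real.pi) = 1 := by
      field_simp
      ring
    rw [this, ENNReal.ofReal_one]

/-- The push-forward of g⊗g is a positive measure which on bounded sets equals ∫ F, hence is
dominated by |F|. Boundedness of S enters because densities are only tested on bounded sets. -/
lemma lintegral_comp_sumMap_le {φ : Plane → ℝ} (hφ : Continuous φ) {f : Plane → ℂ}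
    (hf : Measurable f) {g : Plane → ℝ} (hg0 : ∀ y, 0 ≤ g y) (hg : Integrable g)
    (hfg : f =ᵐ[volume] fun y => (g y : ℂ)) {F : Space → ℂ} (hF : IsSelfConvDensity φ f F)
    {S : Set Space} (hS : MeasurableSet S) (hSb : Bornology.IsBounded S) {Φ : Space → ℝ≥0∞}
    (hΦ : Measurable Φ) :
    ∫⁻ p in sumMap φ ⁻¹' S, Φ (sumMap φ p) * ENNReal.ofReal (g p.1 * g p.2) ≤
      ∫⁻ x in S, Φ x * ‖F x‖ₑ := by
  have hms := (continuous_sumMap hφ).measurable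
  have hgg : Integrable fun p : Plane × Plane => g p.1 * g p.2 := hg.mul_prod hg
  have hggm : AEMeasurable (fun p : Plane × Plane => ENNReal.ofReal (g p.1 * g p.2)) volume :=
    hgg.aestronglyMeasurable.aemeasurable.ennreal_ofReal
  have hFm : AEMeasurable (fun x => ‖F x‖ₑ) volume := hF.1.aestronglyMeasurable.enorm
  have hae : (fun p : Plane × Plane => f p.1 * f p.2) =ᵐ[volume]
      fun p => ((g p.1 * g p.2 : ℝ) : ℂ) := by
    filter_upwards [Measure.quasiMeasurePreserving_fst.ae hfg,
      Measure.quasiMeasurePreserving_snd.ae hfg] with p h1 h2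
    rw [h1, h2, Complex.ofReal_mul]
  have hle : ((volume.withDensity fun p : Plane × Plane => ENNReal.ofReal (g p.1 * g p.2)).restrict
      (sumMap φ ⁻¹' S)).map (sumMap φ) ≤ (volume.withDensity fun x => ‖F x‖ₑ).restrict S := by
    refine Measure.le_iff.2 fun B hB => ?_
    rw [Measure.map_apply hms hB, Measure.restrict_apply (hms hB), Measure.restrict_apply hB,
      ← preimage_inter, withDensity_apply _ (hms (hB.inter hS)), withDensity_apply _ (hB.inter hS),
      ← ofReal_integral_eq_lintegral_ofReal hgg.integrableOn
        (Eventually.of_forall fun p => mul_nonneg (hg0 _) (hg0 _))]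
    have h1 := hF.2 (B ∩ S) (hB.inter hS) (hSb.subset inter_subset_right)
    rw [selfConv_eq hφ hf (hB.inter hS),
      setIntegral_congr_ae (hms (hB.inter hS)) (hae.mono fun p hp _ => hp),
      integral_complex_ofReal] at h1
    refine le_trans (le_of_eq ?_) (enorm_integral_le_lintegral_enorm F)
    rw [← h1, ← ofReal_norm, Complex.norm_real, Real.norm_of_nonneg]
    exact integral_nonneg fun p => mul_nonneg (hg0 _) (hg0 _)
  calc ∫⁻ p in sumMap φ ⁻¹' S, Φ (sumMap φ p) * ENNReal.ofReal (g p.1 * g p.2)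
      = ∫⁻ x, Φ x ∂((volume.withDensity fun p : Plane × Plane =>
          ENNReal.ofReal (g p.1 * g p.2)).restrict (sumMap φ ⁻¹' S)).map (sumMap φ) := by
        rw [lintegral_map hΦ hms, restrict_withDensity (hms hS),
          lintegral_withDensity_eq_lintegral_mul₀ hggm.restrict (by fun_prop)]
        simp only [Pi.mul_apply, mul_comm]
    _ ≤ ∫⁻ x, Φ x ∂(volume.withDensity fun x => ‖F x‖ₑ).restrict S := lintegral_mono' hle le_rfl
    _ = _ := by
        rw [restrict_withDensity hS, lintegral_withDensity_eq_lintegral_mul₀ hFm.restrict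
          hΦ.aemeasurable]
        simp only [Pi.mul_apply, mul_comm]

/-! ### Exponential trial functions adapted to a tangent plane. -/

/-- The difference between `ψ` and its affine approximation at `y₀`. -/
noncomputable def excess (φ : Plane → ℝ) (y₀ y : Plane) : ℝ :=
  ‖y - y₀‖ ^ 2 + (φ y - φ y₀ - fderiv ℝ φ y₀ (y - y₀))

/-- The affine function on `ℝ² × ℝ` which pulls back under `sumMap` to a sum of excesses. -/
noncomputable def sumExcess (φ : Plane → ℝ) (y₀ : Plane) (x : Space) : ℝ :=
  x.2 - (2 * inner ℝ y₀ x.1 - 2 * ‖y₀‖ ^ 2 + 2 * φ y₀ +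
    fderiv ℝ φ y₀ (x.1 - (2 : ℝ) • y₀))

lemma sumExcess_sumMap (φ : Plane → ℝ) (y₀ : Plane) (p : Plane × Plane) :
    sumExcess φ y₀ (sumMap φ p) = excess φ y₀ p.1 + excess φ y₀ p.2 := by
  have h1 : p.1 + p.2 - (2 : ℝ) • y₀ = (p.1 - y₀) + (p.2 - y₀) := by module
  simp only [sumExcess, sumMap, excess, psi, h1, map_add, norm_sub_sq_real, inner_add_right,
    real_inner_comm y₀]
  ring

lemma continuous_excess {φ : Plane → ℝ} (hφ : Continuous φ) (y₀ : Plane) :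
    Continuous (excess φ y₀) := by
  unfold excess
  fun_prop

lemma continuous_sumExcess (φ : Plane → ℝ) (y₀ : Plane) : Continuous (sumExcess φ y₀) := by
  unfold sumExcess
  fun_prop

lemma norm_sq_le_excess {φ : Plane → ℝ} (hd : Differentiable ℝ φ) (hc : ConvexOn ℝ univ φ)
    (y₀ y : Plane) : ‖y - y₀‖ ^ 2 ≤ excess φ y₀ y := by
  have := tangent_le hd hc y y₀
  unfold excess
  linarith

lemma two_excess_lt {φ : Plane → ℝ} {y₀ : Plane} {x : Space} (hx : x ∈ sumRegion φ) :
    2 * excess φ y₀ ((1 / 2 : ℝ) • x.1) < sumExcess φ y₀ x := by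
  have h1 := sumExcess_sumMap φ y₀ ((1 / 2 : ℝ) • x.1, (1 / 2 : ℝ) • x.1)
  have h2 : (1 / 2 : ℝ) • x.1 + (1 / 2 : ℝ) • x.1 = x.1 := by module
  have hx : 2 * psi φ ((1 / 2 : ℝ) • x.1) < x.2 := hx
  simp only [sumMap, h2] at h1
  simp only [sumExcess] at h1 ⊢
  linarith

lemma isBounded_sumRegion_inter {φ : Plane → ℝ} (hd : Differentiable ℝ φ)
    (hc : ConvexOn ℝ univ φ) (y₀ : Plane) (s : ℝ) :
    Bornology.IsBounded (sumRegion φ ∩ {x | sumExcess φ y₀ x < s}) := by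
  -- In the sheared coordinates (ξ, `sumExcess`) the set lies in this product. The map below undoes
  -- the shear.
  have hcomp : IsCompact ((Metric.closedBall ((2 : ℝ) • y₀) (s + 2)) ×ˢ Icc (0 : ℝ) s) :=
    (isCompact_closedBall _ _).prod isCompact_Icc
  have hcont : Continuous fun x : Space => (x.1, x.2 - sumExcess φ y₀ (x.1, 0)) := by
    have := continuous_sumExcess φ y₀
    fun_prop
  refine (hcomp.image hcont).isBounded.subset ?_
  rintro ⟨ξ, τ⟩ ⟨hx, hs⟩
  have h1 := two_excess_lt (y₀ := y₀) hx
  have h2 := norm_sq_le_excess hd hc y₀ ((1 / 2 : ℝ) • ξ)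
  have hs : sumExcess φ y₀ (ξ, τ) < s := hs
  simp only at h1
  have h3 : ‖(1 / 2 : ℝ) • ξ - y₀‖ = ‖ξ - (2 : ℝ) • y₀‖ / 2 := by
    have : (1 / 2 : ℝ) • ξ - y₀ = (1 / 2 : ℝ) • (ξ - (2 : ℝ) • y₀) := by module
    rw [this, norm_smul]
    norm_num
    ring
  rw [h3] at h2
  refine ⟨(ξ, sumExcess φ y₀ (ξ, τ)), ⟨?_, ?_⟩, ?_⟩
  · rw [mem_closedBall_iff_norm]
    nlinarith [sq_nonneg (‖ξ - (2 : ℝ) • y₀‖ - 1)]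
  · simp only [mem_Icc]
    have : 0 ≤ (‖ξ - (2 : ℝ) • y₀‖ / 2) ^ 2 := by positivity
    constructor <;> linarith
  · simp [sumExcess]
    ring

lemma lintegral_mul_le_sqrt {α : Type*} [MeasurableSpace α] {μ : Measure α} {f g : α → ℝ≥0∞}
    (hf : AEMeasurable f μ) (hg : AEMeasurable g μ) :
    ∫⁻ x, f x * g x ∂μ ≤
      (∫⁻ x, f x ^ 2 ∂μ) ^ (1 / 2 : ℝ) * (∫⁻ x, g x ^ 2 ∂μ) ^ (1 / 2 : ℝ) := by
  have := ENNReal.lintegral_mul_le_Lp_mul_Lq μ (p := 2) (q := 2) Real.HolderConjugate.two_two hf hg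
  simpa using this

/-- The mass of `exp (-2 λ excess)` on the sublevel set `{excess < s}`. -/
noncomputable def sublevelMass (φ : Plane → ℝ) (y₀ : Plane) (l s : ℝ) : ℝ≥0∞ :=
  ∫⁻ y in {y | excess φ y₀ y < s}, ENNReal.ofReal (Real.exp (-(2 * l * excess φ y₀ y)))

lemma volume_sublevel_lt_top {φ : Plane → ℝ} (hd : Differentiable ℝ φ) (hc : ConvexOn ℝ univ φ)
    (y₀ : Plane) (s : ℝ) : volume {y | excess φ y₀ y < s} < ∞ := by
  refine (measure_mono ?_).trans_lt (measure_closedBall_lt_top (x := y₀) (r := s + 1))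
  intro y hy
  have := norm_sq_le_excess hd hc y₀ y
  have hy : excess φ y₀ y < s := hy
  rw [mem_closedBall_iff_norm]
  nlinarith [sq_nonneg (‖y - y₀‖ - 1)]

lemma volume_sublevel_pos {φ : Plane → ℝ} (hφ : Continuous φ) (y₀ : Plane) {s : ℝ} (hs : 0 < s) :
    0 < volume {y | excess φ y₀ y < s} := by
  have hq := continuous_excess hφ y₀
  refine IsOpen.measure_pos _ (isOpen_lt hq continuous_const) ⟨y₀, ?_⟩
  simpa [excess] using hs

lemma sublevelMass_pos {φ : Plane → ℝ} (hφ : Continuous φ) (y₀ : Plane) (l : ℝ) {s : ℝ}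
    (hs : 0 < s) : sublevelMass φ y₀ l s ≠ 0 := by
  have hq := continuous_excess hφ y₀
  have hms := (isOpen_lt hq (continuous_const (y := s))).measurableSet
  unfold sublevelMass
  rw [← pos_iff_ne_zero, lintegral_pos_iff_support (by fun_prop)]
  have : Function.support (fun y => ENNReal.ofReal (Real.exp (-(2 * l * excess φ y₀ y)))) = univ :=
    eq_univ_of_forall fun y => by simp [Real.exp_pos]
  rw [this, Measure.restrict_apply_univ]
  exact volume_sublevel_pos hφ y₀ hs

lemma sublevelMass_lt_top {φ : Plane → ℝ} (hd : Differentiable ℝ φ) (hc : ConvexOn ℝ univ φ)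
    (y₀ : Plane) {l : ℝ} (hl : 0 ≤ l) (s : ℝ) : sublevelMass φ y₀ l s < ∞ := by
  refine lt_of_le_of_lt (lintegral_mono (g := fun _ => 1) fun y => ?_) ?_
  · have := norm_sq_le_excess hd hc y₀ y
    rw [← ENNReal.ofReal_one]
    refine ENNReal.ofReal_le_ofReal (Real.exp_le_one_iff.2 ?_)
    have : 0 ≤ excess φ y₀ y := le_trans (by positivity) this
    have : 0 ≤ 2 * l * excess φ y₀ y := by positivity
    linarith
  · simpa using volume_sublevel_lt_top hd hc y₀ s

/-- For large l the exponential puts nearly all its mass where the excess is small. This absorbs the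
mismatch between levels s/2 and s in the Cauchy–Schwarz test. -/
lemma exists_sublevelMass_le {φ : Plane → ℝ} (hd : Differentiable ℝ φ) (hc : ConvexOn ℝ univ φ)
    (y₀ : Plane) {s : ℝ} (hs : 0 < s) {δ : ℝ} (hδ : 0 < δ) :
    ∃ l ≥ 0, sublevelMass φ y₀ l s ≤ ENNReal.ofReal (1 + δ) * sublevelMass φ y₀ l (s / 2) := by
  have hq := continuous_excess hd.continuous y₀
  have hms : ∀ s, MeasurableSet {y | excess φ y₀ y < s} := fun s =>
    (isOpen_lt hq (continuous_const (y := s))).measurableSet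
  set V := (volume {y | excess φ y₀ y < s}).toReal with hV
  -- The integrand is at least exp(-ls/2) below level s/4 and at most exp(-ls) above level s/2, so
  -- the ratio of the two contributions decays like exp(-ls/2).
  set v := (volume {y | excess φ y₀ y < s / 4}).toReal with hv
  have hV0 : 0 < V := ENNReal.toReal_pos (volume_sublevel_pos hd.continuous y₀ hs).ne'
    (volume_sublevel_lt_top hd hc y₀ s).ne
  have hv0 : 0 < v := ENNReal.toReal_pos
    (volume_sublevel_pos hd.continuous y₀ (by positivity)).ne'
    (volume_sublevel_lt_top hd hc y₀ _).ne
  have hlim : Tendsto (fun l : ℝ => Real.exp (-(l * (s / 2)))) atTop (𝓝 0) :=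
    Real.tendsto_exp_neg_atTop_nhds_zero.comp (tendsto_id.atTop_mul_const (by positivity))
  obtain ⟨l, hl, hl0⟩ := ((hlim.eventually_lt_const (by positivity : 0 < δ * v / V)).and
    (eventually_ge_atTop 0)).exists
  refine ⟨l, hl0, ?_⟩
  have hsplit : {y | excess φ y₀ y < s} =
      {y | excess φ y₀ y < s / 2} ∪ ({y | excess φ y₀ y < s} \ {y | excess φ y₀ y < s / 2}) := by
    rw [union_sdiff_cancel]
    intro y hy
    have hy : excess φ y₀ y < s / 2 := hy
    show excess φ y₀ y < s
    linarith
  have h1 : sublevelMass φ y₀ l s = sublevelMass φ y₀ l (s / 2) +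
      ∫⁻ y in {y | excess φ y₀ y < s} \ {y | excess φ y₀ y < s / 2},
        ENNReal.ofReal (Real.exp (-(2 * l * excess φ y₀ y))) := by
    unfold sublevelMass
    conv_lhs => rw [hsplit]
    exact lintegral_union ((hms _).diff (hms _)) disjoint_sdiff_right
  have h2 : ∫⁻ y in {y | excess φ y₀ y < s} \ {y | excess φ y₀ y < s / 2},
      ENNReal.ofReal (Real.exp (-(2 * l * excess φ y₀ y))) ≤
        ENNReal.ofReal (Real.exp (-(l * s)) * V) := by
    calc _ ≤ ∫⁻ y in {y | excess φ y₀ y < s} \ {y | excess φ y₀ y < s / 2},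
          ENNReal.ofReal (Real.exp (-(l * s))) := by
          refine setLIntegral_mono measurable_const fun y hy => ?_
          have hy : ¬ excess φ y₀ y < s / 2 := hy.2
          refine ENNReal.ofReal_le_ofReal (Real.exp_le_exp.2 ?_)
          nlinarith
      _ ≤ ENNReal.ofReal (Real.exp (-(l * s))) * volume {y | excess φ y₀ y < s} := by
          rw [setLIntegral_const]
          gcongr
          exact sdiff_subset
      _ = _ := by
          rw [ENNReal.ofReal_mul (Real.exp_pos _).le, hV,
            ENNReal.ofReal_toReal (volume_sublevel_lt_top hd hc y₀ s).ne]
  have h3 : ENNReal.ofReal (Real.exp (-(l * (s / 2))) * v) ≤ sublevelMass φ y₀ l (s / 2) := by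
    calc _ = ∫⁻ y in {y | excess φ y₀ y < s / 4}, ENNReal.ofReal (Real.exp (-(l * (s / 2)))) := by
          rw [setLIntegral_const, ENNReal.ofReal_mul (Real.exp_pos _).le, hv,
            ENNReal.ofReal_toReal (volume_sublevel_lt_top hd hc y₀ _).ne]
      _ ≤ ∫⁻ y in {y | excess φ y₀ y < s / 4},
            ENNReal.ofReal (Real.exp (-(2 * l * excess φ y₀ y))) := by
          refine setLIntegral_mono (by fun_prop) fun y hy => ?_
          have hy : excess φ y₀ y < s / 4 := hy
          refine ENNReal.ofReal_le_ofReal (Real.exp_le_exp.2 ?_)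
          nlinarith
      _ ≤ _ := by
          refine lintegral_mono_set fun y hy => ?_
          have hy : excess φ y₀ y < s / 4 := hy
          show excess φ y₀ y < s / 2
          linarith
  have h4 : Real.exp (-(l * s)) * V ≤ δ * (Real.exp (-(l * (s / 2))) * v) := by
    have e : Real.exp (-(l * s)) = Real.exp (-(l * (s / 2))) * Real.exp (-(l * (s / 2))) := by
      rw [← Real.exp_add]
      congr 1
      ring
    rw [e]
    rw [lt_div_iff₀ hV0] at hl
    nlinarith [Real.exp_pos (-(l * (s / 2)))]
  rw [h1, ENNReal.ofReal_add zero_le_one hδ.le, ENNReal.ofReal_one, add_mul, one_mul]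
  gcongr
  refine h2.trans ((ENNReal.ofReal_le_ofReal h4).trans ?_)
  rw [ENNReal.ofReal_mul hδ.le]
  gcongr

/-- The truncated generalized Gaussian concentrated near `y₀`. -/
noncomputable def bump (φ : Plane → ℝ) (y₀ : Plane) (l s : ℝ) : Plane → ℝ :=
  {y | excess φ y₀ y < s}.indicator fun y => Real.exp (-(l * excess φ y₀ y))

lemma bump_nonneg (φ : Plane → ℝ) (y₀ : Plane) (l s : ℝ) (y : Plane) : 0 ≤ bump φ y₀ l s y :=
  indicator_nonneg (fun _ _ => (Real.exp_pos _).le) y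

lemma bump_mul_self (φ : Plane → ℝ) (y₀ : Plane) (l s : ℝ) (y : Plane) :
    bump φ y₀ l s y * bump φ y₀ l s y =
      {y | excess φ y₀ y < s}.indicator (fun y => Real.exp (-(2 * l * excess φ y₀ y))) y := by
  unfold bump
  by_cases hy : y ∈ {y | excess φ y₀ y < s}
  · rw [indicator_of_mem hy, indicator_of_mem hy, ← Real.exp_add]
    congr 1
    ring
  · simp [indicator_of_notMem hy]

lemma measurableSet_sublevel {φ : Plane → ℝ} (hφ : Continuous φ) (y₀ : Plane) (s : ℝ) :
    MeasurableSet {y | excess φ y₀ y < s} :=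
  (isOpen_lt (continuous_excess hφ y₀) continuous_const).measurableSet

lemma measurable_bump {φ : Plane → ℝ} (hφ : Continuous φ) (y₀ : Plane) (l s : ℝ) :
    Measurable (bump φ y₀ l s) := by
  have := continuous_excess hφ y₀
  exact Measurable.indicator (by fun_prop) (measurableSet_sublevel hφ y₀ s)

lemma memLp_bump {φ : Plane → ℝ} (hd : Differentiable ℝ φ) (hc : ConvexOn ℝ univ φ)
    (y₀ : Plane) {l : ℝ} (hl : 0 ≤ l) (s : ℝ) (p : ℝ≥0∞) :
    MemLp (bump φ y₀ l s) p volume := by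
  have hq := continuous_excess hd.continuous y₀
  unfold bump
  rw [memLp_indicator_iff_restrict (measurableSet_sublevel hd.continuous y₀ s)]
  have : IsFiniteMeasure (volume.restrict {y | excess φ y₀ y < s}) :=
    ⟨by simpa using volume_sublevel_lt_top hd hc y₀ s⟩
  refine MemLp.of_bound (Measurable.aestronglyMeasurable (by fun_prop)) 1
    (Eventually.of_forall fun y => ?_)
  have := norm_sq_le_excess hd hc y₀ y
  have : 0 ≤ excess φ y₀ y := le_trans (by positivity) this
  have : 0 ≤ l * excess φ y₀ y := by positivity
  rw [Real.norm_of_nonneg (Real.exp_pos _).le, Real.exp_le_one_iff]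
  linarith

lemma lintegral_bump_mul_self {φ : Plane → ℝ} (hφ : Continuous φ) (y₀ : Plane) (l s : ℝ) :
    ∫⁻ y, ENNReal.ofReal (bump φ y₀ l s y * bump φ y₀ l s y) = sublevelMass φ y₀ l s := by
  unfold sublevelMass
  rw [← lintegral_indicator (measurableSet_sublevel hφ y₀ s)]
  refine lintegral_congr fun y => ?_
  rw [bump_mul_self]
  by_cases hy : y ∈ {y | excess φ y₀ y < s}
  · rw [indicator_of_mem hy, indicator_of_mem hy]
  · rw [indicator_of_notMem hy, indicator_of_notMem hy, ENNReal.ofReal_zero]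

/-- A pair measure pushes forward to a measure carried by the region, and its density is positive,
so Lebesgue null sets are null for it and conversely. -/
lemma ae_sumMap_mem_sumRegion {φ : Plane → ℝ} (h : ContDiff ℝ 1 φ) (hc : ConvexOn ℝ univ φ) :
    ∀ᵐ p : Plane × Plane, sumMap φ p ∈ sumRegion φ := by
  have hd : Differentiable ℝ φ := h.differentiable one_ne_zero
  have hreg := (isOpen_sumRegion h.continuous).measurableSet
  have hmd := measurable_pairDensity h isAngularDensity_const
  have h1 : ∀ᵐ p ∂(pairMeasure φ fun _ _ => (2 * Real.pi)⁻¹), sumMap φ p ∈ sumRegion φ :=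
    (measurePreserving_sumMap h hc isAngularDensity_const).quasiMeasurePreserving.ae
      (ae_restrict_mem hreg)
  refine (withDensity_absolutelyContinuous' (by fun_prop) ?_).ae_le h1
  refine Eventually.of_forall fun p => ?_
  have := pairDensity_pos hd hc isAngularDensity_const p
  simpa using this

/-- A lower bound for the norm of any self-convolution density of the truncated Gaussian. -/
lemma sublevelMass_sq_le {φ : Plane → ℝ} (h : ContDiff ℝ 1 φ) (hc : ConvexOn ℝ univ φ)
    (y₀ : Plane) {s ε l : ℝ} (hs : 0 < s) (hε : 0 ≤ ε) (hl : 0 ≤ l)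
    (hgap : ∀ y z, excess φ y₀ y < s → excess φ y₀ z < s →
      gradGap φ y z ≤ ε * ‖y - z‖ ^ 2) {f : Plane → ℂ} (hf : Measurable f)
    (hfg : f =ᵐ[volume] fun y => (bump φ y₀ l (s / 2) y : ℂ)) :
    sublevelMass φ y₀ l (s / 2) ^ 2 ≤
      (ENNReal.ofReal ((2 + ε) / Real.pi) ^ (1 / 2 : ℝ) * sublevelMass φ y₀ l s) *
        selfConvNorm φ f := by
  have hd : Differentiable ℝ φ := h.differentiable one_ne_zero
  have hq := continuous_excess hd.continuous y₀
  have hQ := continuous_sumExcess φ y₀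
  have hms := (continuous_sumMap h.continuous).measurable
  have hq0 : ∀ y, 0 ≤ excess φ y₀ y := fun y =>
    le_trans (by positivity) (norm_sq_le_excess hd hc y₀ y)
  set S := sumRegion φ ∩ {x | sumExcess φ y₀ x < s} with hSdef
  have hQS : MeasurableSet {x | sumExcess φ y₀ x < s} :=
    (isOpen_lt hQ continuous_const).measurableSet
  have hS : MeasurableSet S := (isOpen_sumRegion h.continuous).measurableSet.inter hQS
  have hSb : Bornology.IsBounded S := isBounded_sumRegion_inter hd hc y₀ s
  -- Pulled back to pairs, Φ is the tensor square of the untruncated exponential. Testing F against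
  -- Φ is thus near equality in Cauchy–Schwarz.
  set Φ : Space → ℝ≥0∞ := fun x => ENNReal.ofReal (Real.exp (-(l * sumExcess φ y₀ x))) with hΦdef
  have hΦ : Measurable Φ := by fun_prop
  have hΦsq : ∀ x, Φ x ^ 2 = ENNReal.ofReal (Real.exp (-(2 * l * sumExcess φ y₀ x))) := by
    intro x
    rw [hΦdef, ← ENNReal.ofReal_pow (Real.exp_pos _).le, ← Real.exp_nat_mul]
    congr 2
    push_cast
    ring
  have hleft : sublevelMass φ y₀ l (s / 2) ^ 2 ≤ ∫⁻ p in sumMap φ ⁻¹' S,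
      Φ (sumMap φ p) * ENNReal.ofReal (bump φ y₀ l (s / 2) p.1 * bump φ y₀ l (s / 2) p.2) := by
    have hbm := measurable_bump h.continuous y₀ l (s / 2)
    rw [← lintegral_indicator (hms hS), sq, ← lintegral_bump_mul_self h.continuous,
      ← lintegral_prod_mul
        (f := fun y => ENNReal.ofReal (bump φ y₀ l (s / 2) y * bump φ y₀ l (s / 2) y))
        (g := fun y => ENNReal.ofReal (bump φ y₀ l (s / 2) y * bump φ y₀ l (s / 2) y))
        (by fun_prop) (by fun_prop)]
    refine lintegral_mono_ae ?_
    filter_upwards [ae_sumMap_mem_sumRegion h hc] with p hp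
    by_cases h1 : excess φ y₀ p.1 < s / 2
    · by_cases h2 : excess φ y₀ p.2 < s / 2
      -- Truncating the trial function at s/2 keeps the sum of two excesses below s. Conversely,
      -- since excesses are nonnegative, a sum below s forces each below s in the estimate of ∫ Φ².
      · have hpS : p ∈ sumMap φ ⁻¹' S := by
          refine ⟨hp, ?_⟩
          show sumExcess φ y₀ (sumMap φ p) < s
          rw [sumExcess_sumMap]
          linarith
        rw [indicator_of_mem hpS, bump_mul_self, bump_mul_self]
        have h1' : p.1 ∈ {y | excess φ y₀ y < s / 2} := h1
        have h2' : p.2 ∈ {y | excess φ y₀ y < s / 2} := h2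
        simp only [bump, hΦdef]
        rw [indicator_of_mem h1', indicator_of_mem h2', indicator_of_mem h1',
          indicator_of_mem h2', sumExcess_sumMap, ← ENNReal.ofReal_mul (Real.exp_pos _).le,
          ← ENNReal.ofReal_mul (Real.exp_pos _).le, ← Real.exp_add, ← Real.exp_add,
          ← Real.exp_add]
        refine le_of_eq ?_
        congr 2
        ring
      · have : bump φ y₀ l (s / 2) p.2 = 0 :=
          indicator_of_notMem (s := {y | excess φ y₀ y < s / 2}) h2 _
        simp [this]
    · have : bump φ y₀ l (s / 2) p.1 = 0 :=
        indicator_of_notMem (s := {y | excess φ y₀ y < s / 2}) h1 _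
      simp [this]
  have hsq : ∫⁻ x in S, Φ x ^ 2 ≤
      ENNReal.ofReal ((2 + ε) / Real.pi) * sublevelMass φ y₀ l s ^ 2 := by
    have hsm := measurableSet_sublevel h.continuous y₀ s
    have hem : Measurable fun y => {y | excess φ y₀ y < s}.indicator
        (fun y => ENNReal.ofReal (Real.exp (-(2 * l * excess φ y₀ y)))) y :=
      Measurable.indicator (by fun_prop) hsm
    calc ∫⁻ x in S, Φ x ^ 2
        = ∫⁻ x in sumRegion φ, {x | sumExcess φ y₀ x < s}.indicator (fun x => Φ x ^ 2) x := by
          rw [lintegral_indicator hQS, Measure.restrict_restrict hQS, hSdef, inter_comm]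
      _ = ∫⁻ p, ENNReal.ofReal (pairDensity φ (fun _ _ => (2 * Real.pi)⁻¹) p) *
            {x | sumExcess φ y₀ x < s}.indicator (fun x => Φ x ^ 2) (sumMap φ p) :=
          (lintegral_comp_sumMap h hc isAngularDensity_const
            ((hΦ.pow_const 2).indicator hQS)).symm
      _ ≤ ∫⁻ p : Plane × Plane, ENNReal.ofReal ((2 + ε) / Real.pi) *
            ({y | excess φ y₀ y < s}.indicator
                (fun y => ENNReal.ofReal (Real.exp (-(2 * l * excess φ y₀ y)))) p.1 *
              {y | excess φ y₀ y < s}.indicator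
                (fun y => ENNReal.ofReal (Real.exp (-(2 * l * excess φ y₀ y)))) p.2) := by
          refine lintegral_mono fun p => ?_
          by_cases hp : sumMap φ p ∈ {x | sumExcess φ y₀ x < s}
          · have hp' : excess φ y₀ p.1 + excess φ y₀ p.2 < s := by
              rw [← sumExcess_sumMap]
              exact hp
            have h1 : excess φ y₀ p.1 < s := by linarith [hq0 p.2]
            have h2 : excess φ y₀ p.2 < s := by linarith [hq0 p.1]
            have h1' : p.1 ∈ {y | excess φ y₀ y < s} := h1
            have h2' : p.2 ∈ {y | excess φ y₀ y < s} := h2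
            rw [indicator_of_mem hp, indicator_of_mem h1', indicator_of_mem h2', hΦsq,
              sumExcess_sumMap, ← ENNReal.ofReal_mul (Real.exp_pos _).le, ← Real.exp_add]
            have e : -(2 * l * (excess φ y₀ p.1 + excess φ y₀ p.2)) =
              -(2 * l * excess φ y₀ p.1) + -(2 * l * excess φ y₀ p.2) := by ring
            rw [e]
            gcongr
            have hj : jac φ p.1 p.2 ≤ 4 + 2 * ε := by
              have hg := hgap _ _ h1 h2
              unfold jac
              rcases eq_or_ne p.1 p.2 with h12 | h12
              · simp [h12, hε]
              · have : 0 < ‖p.1 - p.2‖ ^ 2 := pow_pos (norm_sub_pos_iff.2 h12) 2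
                have : 2 * gradGap φ p.1 p.2 / ‖p.1 - p.2‖ ^ 2 ≤ 2 * ε := by
                  rw [div_le_iff₀ this]
                  linarith
                linarith
            calc pairDensity φ (fun _ _ => (2 * Real.pi)⁻¹) p
                ≤ (4 + 2 * ε) * (2 * Real.pi)⁻¹ :=
                  mul_le_mul_of_nonneg_right hj (by positivity)
              _ = _ := by
                field_simp
                ring
          · rw [indicator_of_notMem hp]
            simp
      _ = _ := by
          rw [lintegral_const_mul' _ _ ENNReal.ofReal_ne_top, Measure.volume_eq_prod,
            lintegral_prod_mul
              (f := {y | excess φ y₀ y < s}.indicator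
                (fun y => ENNReal.ofReal (Real.exp (-(2 * l * excess φ y₀ y)))))
              (g := {y | excess φ y₀ y < s}.indicator
                (fun y => ENNReal.ofReal (Real.exp (-(2 * l * excess φ y₀ y)))))
              hem.aemeasurable hem.aemeasurable,
            lintegral_indicator hsm, sq, sublevelMass]
  have hK0 : ENNReal.ofReal ((2 + ε) / Real.pi) ^ (1 / 2 : ℝ) * sublevelMass φ y₀ l s ≠ ∞ :=
    ENNReal.mul_ne_top (ENNReal.rpow_ne_top_of_nonneg (by norm_num) ENNReal.ofReal_ne_top)
      (sublevelMass_lt_top hd hc y₀ hl s).ne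
  suffices hF : ∀ F, IsSelfConvDensity φ f F → sublevelMass φ y₀ l (s / 2) ^ 2 ≤
      (ENNReal.ofReal ((2 + ε) / Real.pi) ^ (1 / 2 : ℝ) * sublevelMass φ y₀ l s) *
        eLpNorm F 2 volume by
    unfold selfConvNorm
    have hK : ENNReal.ofReal ((2 + ε) / Real.pi) ^ (1 / 2 : ℝ) * sublevelMass φ y₀ l s ≠ 0 :=
      mul_ne_zero (ENNReal.rpow_pos (ENNReal.ofReal_pos.2 (by positivity))
        ENNReal.ofReal_ne_top).ne' (sublevelMass_pos h.continuous y₀ l hs)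
    -- The norm is an infimum over densities, so the constant is divided out before bounding it
    -- below density by density.
    rw [mul_comm, ← ENNReal.div_le_iff_le_mul (Or.inl hK) (Or.inl hK0)]
    refine le_iInf₂ fun F hF' => ?_
    rw [ENNReal.div_le_iff_le_mul (Or.inl hK) (Or.inl hK0), mul_comm]
    exact hF F hF'
  intro F hF
  have hFm : AEMeasurable (fun x => ‖F x‖ₑ) volume := hF.1.aestronglyMeasurable.enorm
  have hFn : (∫⁻ x in S, ‖F x‖ₑ ^ 2) ^ (1 / 2 : ℝ) ≤ eLpNorm F 2 volume := by
    rw [eLpNorm_eq_lintegral_rpow_enorm_toReal two_ne_zero ENNReal.ofNat_ne_top]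
    simp only [ENNReal.toReal_ofNat, ENNReal.rpow_ofNat]
    gcongr
    exact Measure.restrict_le_self
  calc sublevelMass φ y₀ l (s / 2) ^ 2 ≤ ∫⁻ x in S, Φ x * ‖F x‖ₑ :=
        hleft.trans (lintegral_comp_sumMap_le h.continuous hf (bump_nonneg φ y₀ l (s / 2))
          (memLp_one_iff_integrable.1 (memLp_bump hd hc y₀ hl _ 1)) hfg hF hS hSb hΦ)
    _ ≤ (∫⁻ x in S, Φ x ^ 2) ^ (1 / 2 : ℝ) * (∫⁻ x in S, ‖F x‖ₑ ^ 2) ^ (1 / 2 : ℝ) :=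
        lintegral_mul_le_sqrt hΦ.aemeasurable hFm.restrict
    _ ≤ (ENNReal.ofReal ((2 + ε) / Real.pi) * sublevelMass φ y₀ l s ^ 2) ^ (1 / 2 : ℝ) *
          eLpNorm F 2 volume := by gcongr
    _ = _ := by
        rw [ENNReal.mul_rpow_of_nonneg _ _ (by norm_num), ← ENNReal.rpow_natCast_mul]
        norm_num

/-- The excess dominates |y - y₀|², so its sublevel set at ρ² lies in the ball where `jac` ≤ 4 + 2ε.
The factor (1 + δ)² is the truncation loss. -/
lemma le_optConst {φ : Plane → ℝ} (h : ContDiff ℝ 1 φ) (hc : ConvexOn ℝ univ φ)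
    {y₀ : Plane} {ρ ε δ : ℝ} (hρ : 0 < ρ) (hε : 0 ≤ ε) (hδ : 0 < δ)
    (hgap : ∀ y ∈ Metric.ball y₀ ρ, ∀ z ∈ Metric.ball y₀ ρ, gradGap φ y z ≤ ε * ‖y - z‖ ^ 2) :
    ENNReal.ofReal (Real.pi / ((2 + ε) * (1 + δ) ^ 2)) ≤ optConst φ ^ 4 := by
  have hd : Differentiable ℝ φ := h.differentiable one_ne_zero
  have hmem : ∀ y, excess φ y₀ y < ρ ^ 2 → y ∈ Metric.ball y₀ ρ := fun y hy => by
    have := norm_sq_le_excess hd hc y₀ y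
    rw [mem_ball_iff_norm]
    exact lt_of_pow_lt_pow_left₀ 2 hρ.le (by linarith)
  obtain ⟨l, hl, hmass⟩ := exists_sublevelMass_le hd hc y₀ (pow_pos hρ 2) hδ
  have hg : MemLp (fun y => (bump φ y₀ l (ρ ^ 2 / 2) y : ℂ)) 2 volume :=
    (memLp_bump hd hc y₀ hl (ρ ^ 2 / 2) 2).ofReal
  set a := sublevelMass φ y₀ l (ρ ^ 2 / 2) with ha
  have ha0 : a ≠ 0 := sublevelMass_pos h.continuous y₀ l (by positivity)
  have hatop : a ≠ ∞ := (sublevelMass_lt_top hd hc y₀ hl _).ne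
  set f : L2Plane := hg.toLp _
  have hnorm : ‖f‖ₑ ^ 2 = a := by
    have h1 := eLpNorm_nnreal_pow_eq_lintegral (f := fun y => (bump φ y₀ l (ρ ^ 2 / 2) y : ℂ))
      (p := 2) (μ := volume) two_ne_zero
    have h2 : eLpNorm (fun y => (bump φ y₀ l (ρ ^ 2 / 2) y : ℂ)) 2 volume ^ 2 =
      ∫⁻ y, ‖(bump φ y₀ l (ρ ^ 2 / 2) y : ℂ)‖ₑ ^ 2 := by simpa using h1
    rw [Lp.enorm_toLp, h2, ha, ← lintegral_bump_mul_self h.continuous]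
    refine lintegral_congr fun y => ?_
    rw [← ofReal_norm, Complex.norm_real, Real.norm_of_nonneg (bump_nonneg _ _ _ _ _), sq,
      ENNReal.ofReal_mul (bump_nonneg _ _ _ _ _)]
  have hf0 : f ≠ 0 := by
    rintro hf
    rw [hf] at hnorm
    simp at hnorm
    exact ha0 hnorm.symm
  have hlow := sublevelMass_sq_le h hc y₀ (pow_pos hρ 2) hε hl
    (fun y z hy hz => hgap y (hmem y hy) z (hmem z hz)) (Lp.stronglyMeasurable f).measurable
    hg.coeFn_toLp
  have hopt : selfConvNorm φ f ^ 2 ≤ optConst φ ^ 4 * a ^ 2 := by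
    have h1 : selfConvNorm φ f ^ (1 / 2 : ℝ) / ‖f‖ₑ ≤ optConst φ :=
      le_iSup₂ (f := fun (f : L2Plane) (_ : f ≠ 0) => selfConvNorm φ f ^ (1 / 2 : ℝ) / ‖f‖ₑ) f hf0
    rw [ENNReal.div_le_iff_le_mul (Or.inl (by simpa using hf0)) (Or.inl (by simp))] at h1
    calc selfConvNorm φ f ^ 2 = (selfConvNorm φ f ^ (1 / 2 : ℝ)) ^ 4 := by
          rw [← ENNReal.rpow_natCast, ← ENNReal.rpow_natCast, ← ENNReal.rpow_mul]
          norm_num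
      _ ≤ (optConst φ * ‖f‖ₑ) ^ 4 := by gcongr
      _ = _ := by
          rw [← hnorm]
          ring
  set C := (2 + ε) / Real.pi with hC
  have hC0 : 0 < C := by positivity
  have key : a ^ 4 ≤ (ENNReal.ofReal (C * (1 + δ) ^ 2) * optConst φ ^ 4) * a ^ 4 := by
    calc a ^ 4 = (a ^ 2) ^ 2 := by ring
      _ ≤ ((ENNReal.ofReal C ^ (1 / 2 : ℝ) * sublevelMass φ y₀ l (ρ ^ 2)) *
            selfConvNorm φ f) ^ 2 := by gcongr
      _ = ENNReal.ofReal C * sublevelMass φ y₀ l (ρ ^ 2) ^ 2 * selfConvNorm φ f ^ 2 := by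
          rw [mul_pow, mul_pow, ← ENNReal.rpow_mul_natCast]
          norm_num
      _ ≤ ENNReal.ofReal C * (ENNReal.ofReal (1 + δ) * a) ^ 2 * (optConst φ ^ 4 * a ^ 2) := by
          gcongr
      _ = _ := by
          rw [ENNReal.ofReal_mul hC0.le, ENNReal.ofReal_pow (by positivity)]
          ring
  have key2 : 1 ≤ ENNReal.ofReal (C * (1 + δ) ^ 2) * optConst φ ^ 4 := by
    rwa [← one_mul (a ^ 4), ← mul_assoc, mul_one,
      ENNReal.mul_le_mul_iff_left (pow_ne_zero 4 ha0) (ENNReal.pow_ne_top hatop)] at key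
  have e : Real.pi / ((2 + ε) * (1 + δ) ^ 2) = (C * (1 + δ) ^ 2)⁻¹ := by
    rw [hC]
    field_simp
  rw [e, ENNReal.ofReal_inv_of_pos (by positivity)]
  rwa [ENNReal.inv_le_iff_le_mul (fun _ => by simp; positivity) (fun h => absurd h ENNReal.ofReal_ne_top)]

/-- If the gradient of `φ` has arbitrarily small Lipschitz constants on suitable balls, then the
optimal constant is at least the one of the paraboloid. -/
theorem pi_div_two_le_optConst {φ : Plane → ℝ} (h : ContDiff ℝ 1 φ) (hc : ConvexOn ℝ univ φ)
    (hgap : ∀ ε > 0, ∃ y₀, ∃ ρ > 0, ∀ y ∈ Metric.ball y₀ ρ, ∀ z ∈ Metric.ball y₀ ρ,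
      gradGap φ y z ≤ ε * ‖y - z‖ ^ 2) :
    ENNReal.ofReal (Real.pi / 2) ≤ optConst φ ^ 4 := by
  have hlim : Tendsto (fun ε : ℝ => ENNReal.ofReal (Real.pi / ((2 + ε) * (1 + ε) ^ 2))) (𝓝[>] 0)
      (𝓝 (ENNReal.ofReal (Real.pi / 2))) := by
    refine ENNReal.tendsto_ofReal (Tendsto.mono_left ?_ nhdsWithin_le_nhds)
    have : ContinuousAt (fun ε : ℝ => Real.pi / ((2 + ε) * (1 + ε) ^ 2)) 0 :=
      ContinuousAt.div (by fun_prop) (by fun_prop) (by norm_num)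
    simpa [ContinuousAt] using this
  refine le_of_tendsto hlim ?_
  filter_upwards [self_mem_nhdsWithin] with ε hε
  have hε : 0 < ε := hε
  obtain ⟨y₀, ρ, hρ, hg⟩ := hgap ε hε
  exact le_optConst h hc hρ hε.le hε hg

/-! ### The Hessian -/

lemma eq_smul_single_add (v : Plane) :
    v = v 0 • EuclideanSpace.single 0 (1 : ℝ) + v 1 • EuclideanSpace.single 1 (1 : ℝ) := by
  ext i
  fin_cases i <;> simp

lemma fderiv_fderiv_apply (φ : Plane → ℝ) (y v w : Plane) :
    fderiv ℝ (fderiv ℝ φ) y v w = hessian φ y 0 0 * v 0 * w 0 + hessian φ y 0 1 * v 0 * w 1 +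
      hessian φ y 1 0 * v 1 * w 0 + hessian φ y 1 1 * v 1 * w 1 := by
  conv_lhs => rw [eq_smul_single_add v, eq_smul_single_add w]
  simp only [map_add, map_smul, add_apply, smul_apply, smul_eq_mul, hessian, Matrix.of_apply]
  ring

lemma norm_fderiv_fderiv_le (φ : Plane → ℝ) (y : Plane) :
    ‖fderiv ℝ (fderiv ℝ φ) y‖ ≤ |hessian φ y 0 0| + |hessian φ y 0 1| + |hessian φ y 1 0| +
      |hessian φ y 1 1| := by
  refine ContinuousLinearMap.opNorm_le_bound₂ _ (by positivity) fun v w => ?_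
  have hv : ∀ (v : Plane) i, |v i| ≤ ‖v‖ := fun v i => by
    rw [← Real.norm_eq_abs]
    exact PiLp.norm_apply_le v i
  have hvw : ∀ (a : ℝ) i j, |a * v i * w j| ≤ |a| * ‖v‖ * ‖w‖ := fun a i j => by
    rw [abs_mul, abs_mul]
    gcongr
    · exact hv v i
    · exact hv w j
  rw [fderiv_fderiv_apply, Real.norm_eq_abs]
  refine (abs_add_le _ _).trans ?_
  have h1 := abs_add_le (hessian φ y 0 0 * v 0 * w 0 + hessian φ y 0 1 * v 0 * w 1)
    (hessian φ y 1 0 * v 1 * w 0)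
  have h2 := abs_add_le (hessian φ y 0 0 * v 0 * w 0) (hessian φ y 0 1 * v 0 * w 1)
  have h3 := hvw (hessian φ y 0 0) 0 0
  have h4 := hvw (hessian φ y 0 1) 0 1
  have h5 := hvw (hessian φ y 1 0) 1 0
  have h6 := hvw (hessian φ y 1 1) 1 1
  linarith

lemma exists_norm_fderiv_fderiv_lt {φ : Plane → ℝ}
    (hHess : (∃ y₀, hessian φ y₀ = 0) ∨ ∃ y : ℕ → Plane,
      Tendsto (fun n => ‖y n‖) atTop atTop ∧ Tendsto (fun n => hessian φ (y n)) atTop (𝓝 0))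
    {ε : ℝ} (hε : 0 < ε) : ∃ y₀, ‖fderiv ℝ (fderiv ℝ φ) y₀‖ < ε := by
  rcases hHess with ⟨y₀, h0⟩ | ⟨y, -, hy⟩
  · refine ⟨y₀, (norm_fderiv_fderiv_le φ y₀).trans_lt ?_⟩
    simpa [h0] using hε
  · have hij : ∀ i j, Tendsto (fun n => |hessian φ (y n) i j|) atTop (𝓝 0) := fun i j => by
      simpa using ((tendsto_pi_nhds.1 (tendsto_pi_nhds.1 hy i)) j).abs
    have hsum := (((hij 0 0).add (hij 0 1)).add (hij 1 0)).add (hij 1 1)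
    simp only [add_zero] at hsum
    obtain ⟨n, hn⟩ := (hsum.eventually_lt_const hε).exists
    exact ⟨y n, (norm_fderiv_fderiv_le φ (y n)).trans_lt hn⟩

lemma contDiff_fderiv {φ : Plane → ℝ} (h : ContDiff ℝ 2 φ) : ContDiff ℝ 1 (fderiv ℝ φ) :=
  h.fderiv_right (by norm_num)

/-- Strict differentiability of the gradient at y₀ compares two nearby points directly; ordinary
differentiability would control only pairs containing y₀. -/
lemma exists_abs_gradGap_sub_le {φ : Plane → ℝ} (h : ContDiff ℝ 2 φ) (y₀ : Plane) {η : ℝ}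
    (hη : 0 < η) : ∃ ρ > 0, ∀ y ∈ Metric.ball y₀ ρ, ∀ z ∈ Metric.ball y₀ ρ,
      |gradGap φ y z - fderiv ℝ (fderiv ℝ φ) y₀ (y - z) (y - z)| ≤ η * ‖y - z‖ ^ 2 := by
  have hs : HasStrictFDerivAt (fderiv ℝ φ) (fderiv ℝ (fderiv ℝ φ) y₀) y₀ :=
    (contDiff_fderiv h).contDiffAt.hasStrictFDerivAt one_ne_zero
  have h1 := hs.isLittleO.def hη
  obtain ⟨ρ, hρ, hb⟩ := Metric.eventually_nhds_iff_ball.1 h1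
  refine ⟨ρ, hρ, fun y hy z hz => ?_⟩
  have h2 := hb (y, z) (by rw [← ball_prod_same]; exact ⟨hy, hz⟩)
  have h3 : gradGap φ y z - fderiv ℝ (fderiv ℝ φ) y₀ (y - z) (y - z) =
      (fderiv ℝ φ y - fderiv ℝ φ z - fderiv ℝ (fderiv ℝ φ) y₀ (y - z)) (y - z) := rfl
  rw [h3, ← Real.norm_eq_abs, sq, ← mul_assoc]
  exact (ContinuousLinearMap.le_opNorm _ _).trans (by gcongr)

lemma exists_gradGap_le {φ : Plane → ℝ} (h : ContDiff ℝ 2 φ)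
    (hHess : (∃ y₀, hessian φ y₀ = 0) ∨ ∃ y : ℕ → Plane,
      Tendsto (fun n => ‖y n‖) atTop atTop ∧ Tendsto (fun n => hessian φ (y n)) atTop (𝓝 0))
    {ε : ℝ} (hε : 0 < ε) : ∃ y₀, ∃ ρ > 0, ∀ y ∈ Metric.ball y₀ ρ, ∀ z ∈ Metric.ball y₀ ρ,
      gradGap φ y z ≤ ε * ‖y - z‖ ^ 2 := by
  obtain ⟨y₀, hy₀⟩ := exists_norm_fderiv_fderiv_lt hHess (half_pos hε)
  obtain ⟨ρ, hρ, hb⟩ := exists_abs_gradGap_sub_le h y₀ (half_pos hε)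
  refine ⟨y₀, ρ, hρ, fun y hy z hz => ?_⟩
  have h1 := (abs_le.1 (hb y hy z hz)).2
  have h2 : fderiv ℝ (fderiv ℝ φ) y₀ (y - z) (y - z) ≤ ε / 2 * ‖y - z‖ ^ 2 := by
    refine (le_abs_self _).trans ?_
    rw [← Real.norm_eq_abs, sq, ← mul_assoc]
    refine (ContinuousLinearMap.le_opNorm₂ _ _ _).trans ?_
    gcongr
  linarith

lemma fderiv_fderiv_nonneg {φ : Plane → ℝ} (h : ContDiff ℝ 2 φ) (hc : ConvexOn ℝ univ φ)
    (y₀ w : Plane) : 0 ≤ fderiv ℝ (fderiv ℝ φ) y₀ w w := by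
  have hd : Differentiable ℝ φ := h.differentiable two_ne_zero
  have key : ∀ η > 0, -(η * ‖w‖ ^ 2) ≤ fderiv ℝ (fderiv ℝ φ) y₀ w w := fun η hη => by
    obtain ⟨ρ, hρ, hb⟩ := exists_abs_gradGap_sub_le h y₀ hη
    set t : ℝ := ρ / (2 * (‖w‖ + 1)) with ht
    have ht0 : 0 < t := by positivity
    have hmem : y₀ + t • w ∈ Metric.ball y₀ ρ := by
      rw [mem_ball_iff_norm, add_sub_cancel_left, norm_smul, Real.norm_of_nonneg ht0.le, ht,
        div_mul_eq_mul_div, div_lt_iff₀ (by positivity)]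
      nlinarith [norm_nonneg w]
    have h1 := (abs_le.1 (hb _ hmem _ (Metric.mem_ball_self hρ))).2
    have h2 := gradGap_nonneg hd hc (y₀ + t • w) y₀
    simp only [add_sub_cancel_left, map_smul, smul_apply, norm_smul, Real.norm_of_nonneg ht0.le,
      smul_eq_mul] at h1
    have h3 : 0 < t ^ 2 := by positivity
    have h4 : 0 ≤ t ^ 2 * (fderiv ℝ (fderiv ℝ φ) y₀ w w + η * ‖w‖ ^ 2) := by nlinarith
    have := nonneg_of_mul_nonneg_right h4 h3
    linarith
  by_contra hneg
  push Not at hneg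
  -- With this η the permitted negativity is at most half of the assumed one.
  have := key (-(fderiv ℝ (fderiv ℝ φ) y₀ w w) / (2 * (‖w‖ ^ 2 + 1)))
    (div_pos (by linarith) (by positivity))
  have h5 : -(fderiv ℝ (fderiv ℝ φ) y₀ w w) / (2 * (‖w‖ ^ 2 + 1)) * ‖w‖ ^ 2 ≤
      -(fderiv ℝ (fderiv ℝ φ) y₀ w w) / 2 := by
    rw [div_mul_eq_mul_div, div_le_div_iff₀ (by positivity) (by positivity)]
    nlinarith [sq_nonneg ‖w‖]
  linarith

/-- The values of the quadratic form at w and at its quarter turn add up to the trace times |w|²,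
and both are nonnegative. -/
lemma fderiv_fderiv_le_trace {φ : Plane → ℝ} (h : ContDiff ℝ 2 φ) (hc : ConvexOn ℝ univ φ)
    (y₀ w : Plane) :
    fderiv ℝ (fderiv ℝ φ) y₀ w w ≤ (hessian φ y₀ 0 0 + hessian φ y₀ 1 1) * ‖w‖ ^ 2 := by
  have h1 := fderiv_fderiv_nonneg h hc y₀ !₂[w 1, -w 0]
  rw [fderiv_fderiv_apply] at h1 ⊢
  simp only [Matrix.cons_val_zero, Matrix.cons_val_one] at h1
  rw [EuclideanSpace.norm_sq_eq, Fin.sum_univ_two, Real.norm_eq_abs, Real.norm_eq_abs, sq_abs,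
    sq_abs]
  nlinarith

lemma trace_hessian_pos {φ : Plane → ℝ} (h : ContDiff ℝ 2 φ) (hc : ConvexOn ℝ univ φ)
    {y₀ : Plane} (h0 : hessian φ y₀ ≠ 0) : 0 < hessian φ y₀ 0 0 + hessian φ y₀ 1 1 := by
  by_contra hneg
  push Not at hneg
  refine h0 ?_
  have hQ : ∀ a b : ℝ, 0 ≤ hessian φ y₀ 0 0 * a * a + hessian φ y₀ 0 1 * a * b +
      hessian φ y₀ 1 0 * b * a + hessian φ y₀ 1 1 * b * b := fun a b => by
    simpa [fderiv_fderiv_apply] using fderiv_fderiv_nonneg h hc y₀ !₂[a, b]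
  have hsymm : hessian φ y₀ 0 1 = hessian φ y₀ 1 0 :=
    (h.contDiffAt.isSymmSndFDerivAt (by simp)).eq _ _
  have h1 := hQ 1 0
  have h2 := hQ 0 1
  have h3 := hQ 1 1
  have h4 := hQ 1 (-1)
  ext i j
  fin_cases i <;> fin_cases j <;> simp <;> linarith

/-! ### Angular densities and pointwise bounds for the weight -/

lemma lintegral_Ioo_eq_integral {p : ℝ → ℝ} (hp0 : ∀ θ, 0 ≤ p θ)
    (hp : IntervalIntegrable p volume (-Real.pi) Real.pi) :
    ∫⁻ θ in Ioo (-Real.pi) Real.pi, ENNReal.ofReal (p θ) =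
      ENNReal.ofReal (∫ θ in (-Real.pi)..Real.pi, p θ) := by
  have hle : -Real.pi ≤ Real.pi := by linarith [Real.pi_pos]
  rw [intervalIntegral.integral_of_le hle, ofReal_integral_eq_lintegral_ofReal
    ((intervalIntegrable_iff_integrableOn_Ioc_of_le hle).1 hp) (Eventually.of_forall hp0)]
  exact setLIntegral_congr Ioo_ae_eq_Ioc

/-- By strict convexity the gradient gap is positive off the diagonal, hence has a positive minimum
on the compact set of separated pairs. -/
lemma exists_inv_pairDensity_lt_of_separated {φ : Plane → ℝ} (h : ContDiff ℝ 1 φ)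
    (hc : StrictConvexOn ℝ univ φ) (R : ℝ) {ρ : ℝ} (hρ : 0 < ρ) :
    ∃ c < Real.pi / 2, ∀ p : Plane × Plane, ‖p.1‖ ≤ R → ‖p.2‖ ≤ R → ρ ≤ ‖p.1 - p.2‖ →
      (pairDensity φ (fun _ _ => (2 * Real.pi)⁻¹) p)⁻¹ ≤ c := by
  have hd : Differentiable ℝ φ := h.differentiable one_ne_zero
  set K : Set (Plane × Plane) :=
    (Metric.closedBall 0 R ×ˢ Metric.closedBall 0 R) ∩ {p | ρ ≤ ‖p.1 - p.2‖} with hK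
  have hKc : IsCompact K :=
    ((isCompact_closedBall _ _).prod (isCompact_closedBall _ _)).inter_right
      (isClosed_le (by fun_prop) (by fun_prop))
  rcases K.eq_empty_or_nonempty with hKe | hKne
  · refine ⟨0, by positivity, fun p h1 h2 h3 => ?_⟩
    have : p ∈ K := ⟨⟨by simpa using h1, by simpa using h2⟩, h3⟩
    simp [hKe] at this
  · obtain ⟨q, hq, hmin⟩ := hKc.exists_isMinOn hKne (continuous_gradGap h).continuousOn
    have hqne : q.1 ≠ q.2 := by
      intro heq
      have : ρ ≤ ‖q.1 - q.2‖ := hq.2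
      rw [heq, sub_self, norm_zero] at this
      linarith
    set m := gradGap φ q.1 q.2
    have hm : 0 < m := gradGap_pos hd hc hqne
    have hm' : 0 < 2 * m / (4 * R ^ 2 + 1) := by positivity
    refine ⟨2 * Real.pi / (4 + 2 * m / (4 * R ^ 2 + 1)), ?_, fun p h1 h2 h3 => ?_⟩
    · rw [div_lt_div_iff₀ (by positivity) two_pos]
      nlinarith [Real.pi_pos]
    · have hp : p ∈ K := ⟨⟨by simpa using h1, by simpa using h2⟩, h3⟩
      have hg : m ≤ gradGap φ p.1 p.2 := hmin hp
      have hn : ‖p.1 - p.2‖ ≤ 2 * R := (norm_sub_le _ _).trans (by linarith)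
      have hj : 4 + 2 * m / (4 * R ^ 2 + 1) ≤ jac φ p.1 p.2 := by
        have hg0 : 0 ≤ gradGap φ p.1 p.2 := hm.le.trans hg
        have hpos : 0 < ‖p.1 - p.2‖ ^ 2 := pow_pos (by linarith) 2
        have hle : ‖p.1 - p.2‖ ^ 2 ≤ 4 * R ^ 2 + 1 := by nlinarith [norm_nonneg (p.1 - p.2)]
        unfold jac
        gcongr
      unfold pairDensity
      rw [mul_inv, inv_inv, inv_mul_eq_div]
      gcongr

/-- Near y₀ the Jacobian is about 4 + 2x, where x is the Hessian form in the direction of y - z. It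
may be only 4 in a degenerate direction. Lowering P where x exceeds its circular mean t/2 and
raising it elsewhere makes the product exceed 4/(2π) in every direction, since t > 0. -/
lemma exists_angularDensity_of_hessian_ne_zero {φ : Plane → ℝ} (h : ContDiff ℝ 2 φ)
    (hc : ConvexOn ℝ univ φ) {y₀ : Plane} (h0 : hessian φ y₀ ≠ 0) :
    ∃ P, IsAngularDensity P ∧ ∃ M, (∀ p, (pairDensity φ P p)⁻¹ ≤ M) ∧
      ∃ ρ > 0, ∃ c < Real.pi / 2, ∀ y ∈ Metric.ball y₀ ρ, ∀ z ∈ Metric.ball y₀ ρ,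
        (pairDensity φ P (y, z))⁻¹ ≤ c := by
  have hd : Differentiable ℝ φ := h.differentiable two_ne_zero
  have hpi := Real.pi_pos
  set t := hessian φ y₀ 0 0 + hessian φ y₀ 1 1 with ht
  have ht0 : 0 < t := trace_hessian_pos h hc h0
  set Q : Plane → ℝ := fun w => fderiv ℝ (fderiv ℝ φ) y₀ w w with hQ
  set x : Plane → ℝ := fun w => Q w / ‖w‖ ^ 2 with hx
  have hx0 : ∀ w, 0 ≤ x w := fun w => div_nonneg (fderiv_fderiv_nonneg h hc y₀ w) (by positivity)
  have hxt : ∀ w, x w ≤ t := fun w =>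
    div_le_of_le_mul₀ (by positivity) ht0.le (fderiv_fderiv_le_trace h hc y₀ w)
  -- This keeps 1 - ε(x - t/2) ≥ 1/2, and makes the X-coefficient 2 - 4ε - 2εX + εt nonnegative for
  -- X ≤ t.
  set ε := 1 / (2 + t) with hε
  have hε0 : 0 < ε := by positivity
  have hε1 : ε * (2 + t) = 1 := by
    rw [hε]
    field_simp
  set P : Plane → Plane → ℝ := fun _ w => (1 - ε * (x w - t / 2)) / (2 * Real.pi) with hP
  have hεt : 0 < ε * t := by positivity
  have hnum : ∀ w, 1 / 2 ≤ 1 - ε * (x w - t / 2) := fun w => by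
    nlinarith [mul_le_mul_of_nonneg_left (hxt w) hε0.le]
  have hPle : ∀ ξ w, 1 / (4 * Real.pi) ≤ P ξ w := fun ξ w => by
    calc 1 / (4 * Real.pi) = (1 / 2) / (2 * Real.pi) := by field_simp; norm_num
      _ ≤ _ := by
        simp only [hP]
        gcongr
        exact hnum w
  have hQc : Continuous Q := by simp only [hQ]; fun_prop
  have hPdens : IsAngularDensity P := by
    refine ⟨?_, ⟨1 / (4 * Real.pi), by positivity, hPle⟩, fun ξ w r hr => ?_, fun ξ => ?_⟩
    · have hxm : Measurable x := hQc.measurable.div (by fun_prop)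
      have : Measurable fun w : Plane => (1 - ε * (x w - t / 2)) / (2 * Real.pi) := by fun_prop
      exact this.comp measurable_snd
    · have : x (r • w) = x w := by
        simp only [hx, hQ, map_smul, smul_apply, norm_smul, smul_eq_mul,
          Real.norm_of_nonneg hr.le, mul_pow]
        rw [← mul_assoc, ← sq, mul_div_mul_left _ _ (pow_pos hr 2).ne']
      simp only [hP, this]
    · have hPc : Continuous fun θ => P ξ (dir θ) := by
        simp only [hP, hx, norm_dir, one_pow, div_one]
        have : Continuous fun θ => Q (dir θ) := hQc.comp continuous_dir
        exact (continuous_const.sub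
          (continuous_const.mul (this.sub continuous_const))).div_const _
      rw [lintegral_Ioo_eq_integral (fun θ => le_trans (by positivity) (hPle ξ (dir θ)))
        (hPc.intervalIntegrable _ _)]
      -- An explicit primitive: the trigonometric part is periodic, so only θ/(2π) contributes to
      -- the increment.
      set G : ℝ → ℝ := fun θ => (θ - ε * ((hessian φ y₀ 0 0 - hessian φ y₀ 1 1) / 2 *
        (Real.sin θ * Real.cos θ) + (hessian φ y₀ 0 1 + hessian φ y₀ 1 0) / 2 *
          (Real.sin θ) ^ 2)) / (2 * Real.pi) with hG
      have hder : ∀ θ ∈ uIcc (-Real.pi) Real.pi, HasDerivAt G (P ξ (dir θ)) θ := fun θ _ => by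
        have hs := Real.hasDerivAt_sin θ
        have hco := Real.hasDerivAt_cos θ
        refine (((hasDerivAt_id θ).sub ((((hs.mul hco).const_mul
          ((hessian φ y₀ 0 0 - hessian φ y₀ 1 1) / 2)).add ((hs.pow 2).const_mul
            ((hessian φ y₀ 0 1 + hessian φ y₀ 1 0) / 2))).const_mul ε)).div_const
              (2 * Real.pi)).congr_deriv ?_
        simp only [hP, hx, hQ, norm_dir, fderiv_fderiv_apply, ht]
        simp only [dir, PiLp.toLp_apply, Matrix.cons_val_zero, Matrix.cons_val_one]
        congr 1
        have hsq := Real.sin_sq_add_cos_sq θ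
        push_cast
        linear_combination (ε * (hessian φ y₀ 0 0 + hessian φ y₀ 1 1) / 2) * hsq
      rw [intervalIntegral.integral_eq_sub_of_hasDerivAt hder (hPc.intervalIntegrable _ _)]
      have : G Real.pi - G (-Real.pi) = 1 := by
        simp only [hG, Real.sin_pi, Real.sin_neg]
        field_simp
        norm_num
        ring
      rw [this, ENNReal.ofReal_one]
  refine ⟨P, hPdens, Real.pi, fun p => ?_, ?_⟩
  · rw [inv_le_comm₀ (pairDensity_pos hd hc hPdens p) hpi]
    calc Real.pi⁻¹ = 4 * (1 / (4 * Real.pi)) := by field_simp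
      _ ≤ _ := mul_le_mul (four_le_jac hd hc _ _) (hPle (p.1 + p.2) _) (by positivity)
        (by linarith [four_le_jac hd hc p.1 p.2])
  · obtain ⟨ρ, hρ, hb⟩ := exists_abs_gradGap_sub_le h y₀ (η := ε * t / 3) (by positivity)
    refine ⟨ρ, hρ, 2 * Real.pi / (4 + ε * t), ?_, fun y hy z hz => ?_⟩
    · rw [div_lt_div_iff₀ (by positivity) two_pos]
      nlinarith
    · have hj : 4 + 2 * x (y - z) - 2 * (ε * t / 3) ≤ jac φ y z := by
        rcases eq_or_ne y z with rfl | hyz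
        · have : x (y - y) = 0 := by simp [hx]
          rw [this]
          linarith [four_le_jac hd hc y y]
        · have hn : 0 < ‖y - z‖ ^ 2 := pow_pos (norm_sub_pos_iff.2 hyz) 2
          have h1 := (abs_le.1 (hb y hy z hz)).1
          have h2 : x (y - z) - ε * t / 3 ≤ gradGap φ y z / ‖y - z‖ ^ 2 := by
            rw [le_div_iff₀ hn, sub_mul, hx, div_mul_cancel₀ _ hn.ne']
            simp only [hQ]
            linarith
          have h3 : 2 * gradGap φ y z / ‖y - z‖ ^ 2 = 2 * (gradGap φ y z / ‖y - z‖ ^ 2) := by ring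
          unfold jac
          rw [h3]
          linarith
      have hkey : (4 + ε * t) / (2 * Real.pi) ≤ pairDensity φ P (y, z) := by
        have hP' : pairDensity φ P (y, z) =
          jac φ y z * (1 - ε * (x (y - z) - t / 2)) / (2 * Real.pi) := by
          simp only [pairDensity, hP]
          ring
        rw [hP']
        gcongr
        refine le_trans ?_ (mul_le_mul_of_nonneg_right hj (by linarith [hnum (y - z)]))
        set X := x (y - z)
        have hX0 : 0 ≤ X := hx0 _
        have hXt : X ≤ t := hxt _
        have e1 : ε * X ≤ ε * t := by gcongr
        have e2 : 0 ≤ X * (2 - 4 * ε - 2 * (ε * X) + ε * t) :=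
          mul_nonneg hX0 (by nlinarith)
        have e3 : 0 ≤ ε * X := by positivity
        have e4 : ε * t ≤ 1 := by nlinarith
        have e5 : ε * t * (ε * t) ≤ ε * t := by nlinarith
        have e6 : 0 ≤ ε * t * (ε * X) := by positivity
        nlinarith
      have := inv_anti₀ (by positivity) hkey
      rwa [inv_div] at this

/-- The measure of the angles within a double cone around a given line. -/
noncomputable def coneAngle (η : ℝ) : ℝ :=
  ∫ θ in (-Real.pi)..Real.pi, {θ | 1 - η < Real.cos θ ^ 2}.indicator 1 θ

lemma measurableSet_cone (η : ℝ) : MeasurableSet {θ : ℝ | 1 - η < Real.cos θ ^ 2} :=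
  (isOpen_lt continuous_const (Real.continuous_cos.pow 2)).measurableSet

lemma intervalIntegrable_cone (η θ₀ a b : ℝ) :
    IntervalIntegrable (fun θ => {θ : ℝ | 1 - η < Real.cos θ ^ 2}.indicator (1 : ℝ → ℝ) (θ - θ₀))
      volume a b := by
  have hm : Measurable fun θ =>
      {θ : ℝ | 1 - η < Real.cos θ ^ 2}.indicator (1 : ℝ → ℝ) (θ - θ₀) :=
    (measurable_one.indicator (measurableSet_cone η)).comp (measurable_id.sub_const θ₀)
  refine (intervalIntegrable_const (c := (1 : ℝ))).mono_fun hm.aestronglyMeasurable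
    (Eventually.of_forall fun θ => ?_)
  simp only [norm_one]
  exact (norm_indicator_le_norm_self _ _).trans (by simp)

lemma integral_cone_sub (η θ₀ : ℝ) :
    ∫ θ in (-Real.pi)..Real.pi, {θ | 1 - η < Real.cos θ ^ 2}.indicator (1 : ℝ → ℝ) (θ - θ₀) =
      coneAngle η := by
  have hper : Function.Periodic
      ({θ : ℝ | 1 - η < Real.cos θ ^ 2}.indicator (1 : ℝ → ℝ)) (2 * Real.pi) := fun θ => by
    simp [indicator, Real.cos_add_two_pi]
  have := hper.intervalIntegral_add_eq (-Real.pi - θ₀) (-Real.pi)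
  rw [intervalIntegral.integral_comp_sub_right
    (fun θ => {θ | 1 - η < Real.cos θ ^ 2}.indicator (1 : ℝ → ℝ) θ), coneAngle]
  convert this using 2 <;> ring

lemma coneAngle_eq (η : ℝ) : coneAngle η =
    (volume (Ioc (-Real.pi) Real.pi ∩ {θ | 1 - η < Real.cos θ ^ 2})).toReal := by
  rw [coneAngle, intervalIntegral.integral_of_le (by linarith [Real.pi_pos]),
    integral_indicator_one (measurableSet_cone η), measureReal_restrict_apply (measurableSet_cone η),
    inter_comm, Measure.real]

lemma coneAngle_pos {η : ℝ} (hη : 0 < η) : 0 < coneAngle η := by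
  rw [coneAngle_eq]
  refine ENNReal.toReal_pos (ne_of_gt ?_)
    ((measure_mono inter_subset_left).trans_lt (by simp)).ne
  refine lt_of_lt_of_le (IsOpen.measure_pos volume
    (U := Ioo (-Real.pi) Real.pi ∩ {θ | 1 - η < Real.cos θ ^ 2})
    (isOpen_Ioo.inter (isOpen_lt continuous_const (Real.continuous_cos.pow 2))) ⟨0, ?_⟩)
    (measure_mono (inter_subset_inter_left _ Ioo_subset_Ioc_self))
  refine ⟨⟨by linarith [Real.pi_pos], Real.pi_pos⟩, ?_⟩
  simp [hη]

lemma exists_coneAngle_lt {c : ℝ} (hc : 0 < c) : ∃ η > 0, η < 1 ∧ coneAngle η < c := by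
  set s : ℕ → Set ℝ := fun n =>
    Ioc (-Real.pi) Real.pi ∩ {θ | 1 - 1 / ((n : ℝ) + 2) < Real.cos θ ^ 2} with hs
  have hanti : Antitone s := by
    intro m n hmn θ hθ
    refine ⟨hθ.1, ?_⟩
    have h1 : 1 - 1 / ((n : ℝ) + 2) < Real.cos θ ^ 2 := hθ.2
    have h2 : 1 / ((n : ℝ) + 2) ≤ 1 / ((m : ℝ) + 2) := by gcongr
    show 1 - 1 / ((m : ℝ) + 2) < Real.cos θ ^ 2
    linarith
  have hlim := tendsto_measure_iInter_atTop (μ := volume) (s := s)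
    (fun n => (measurableSet_Ioc.inter (measurableSet_cone _)).nullMeasurableSet) hanti
    ⟨0, ((measure_mono inter_subset_left).trans_lt (by simp)).ne⟩
  have hzero : volume (⋂ n, s n) = 0 := by
    refine measure_mono_null (t := {0, Real.pi}) (fun θ hθ => ?_)
      ((Set.toFinite _).measure_zero _)
    rw [mem_iInter] at hθ
    have hθ0 := (hθ 0).1
    have hcos : 1 ≤ Real.cos θ ^ 2 := by
      have hl : Tendsto (fun n : ℕ => 1 - 1 / ((n : ℝ) + 2)) atTop (𝓝 (1 - 0)) := by
        refine tendsto_const_nhds.sub ?_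
        exact tendsto_const_nhds.div_atTop
          (tendsto_natCast_atTop_atTop.atTop_add tendsto_const_nhds)
      rw [sub_zero] at hl
      exact le_of_tendsto' hl fun n => (hθ n).2.le
    have hsin : Real.sin θ = 0 := by
      have := Real.sin_sq_add_cos_sq θ
      have : Real.sin θ ^ 2 ≤ 0 := by linarith
      exact pow_eq_zero_iff two_ne_zero |>.1 (le_antisymm this (sq_nonneg _))
    rcases eq_or_lt_of_le hθ0.2 with h | h
    · right; exact h
    · left; exact (Real.sin_eq_zero_iff_of_lt_of_lt hθ0.1 h).1 hsin
  rw [hzero] at hlim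
  have hlim2 := (ENNReal.tendsto_toReal ENNReal.zero_ne_top).comp hlim
  rw [ENNReal.toReal_zero] at hlim2
  obtain ⟨n, hn⟩ := (hlim2.eventually_lt_const hc).exists
  refine ⟨1 / ((n : ℝ) + 2), by positivity, ?_, ?_⟩
  · rw [div_lt_one (by positivity)]
    have : (0 : ℝ) ≤ n := n.cast_nonneg
    linarith
  · rw [coneAngle_eq]
    exact hn

lemma exists_eq_norm_smul_dir (v : Plane) : ∃ θ, v = ‖v‖ • dir θ := by
  refine ⟨Complex.arg ⟨v 0, v 1⟩, ?_⟩
  have hn : ‖(⟨v 0, v 1⟩ : ℂ)‖ = ‖v‖ := by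
    rw [EuclideanSpace.norm_eq, Fin.sum_univ_two, Complex.norm_def, Complex.normSq_mk]
    simp [sq]
  have h1 := Complex.norm_mul_cos_arg ⟨v 0, v 1⟩
  have h2 := Complex.norm_mul_sin_arg ⟨v 0, v 1⟩
  rw [hn] at h1 h2
  ext i
  fin_cases i
  · simpa [dir] using h1.symm
  · simpa [dir] using h2.symm

lemma inner_dir_dir (θ θ' : ℝ) : inner ℝ (dir θ) (dir θ') = Real.cos (θ - θ') := by
  simp [dir, PiLp.inner_apply, Fin.sum_univ_two, Real.cos_sub]
  ring

/-- The squared cosine of the angle between two vectors. -/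
noncomputable def cosSq (v w : Plane) : ℝ := inner ℝ w v ^ 2 / (‖w‖ ^ 2 * ‖v‖ ^ 2)

lemma exists_cosSq_dir_eq {v : Plane} (hv : v ≠ 0) :
    ∃ θ₀, ∀ θ, cosSq v (dir θ) = Real.cos (θ - θ₀) ^ 2 := by
  obtain ⟨θ₀, h0⟩ := exists_eq_norm_smul_dir v
  refine ⟨θ₀, fun θ => ?_⟩
  have hn : ‖v‖ ≠ 0 := norm_ne_zero_iff.2 hv
  have h1 : inner ℝ (dir θ) v = ‖v‖ * Real.cos (θ - θ₀) := by
    conv_lhs => rw [h0]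
    rw [inner_smul_right, inner_dir_dir]
  rw [cosSq, h1, norm_dir]
  field_simp

/-- When b dominates a, the vectors a + b and a - b are nearly ±b, hence almost antiparallel. -/
lemma lt_cosSq_add_sub {a b : Plane} {η : ℝ} (hη : 0 < η) (hη1 : η < 1) (ha : ‖a‖ < 1)
    (hb : 5 / η ≤ ‖b‖) : 1 - η < cosSq (a + b) (a - b) := by
  rw [div_le_iff₀ hη] at hb
  have hb5 : 5 < ‖b‖ := by
    have : ‖b‖ * η < ‖b‖ * 1 := by
      refine mul_lt_mul_of_pos_left hη1 ?_
      by_contra hneg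
      push Not at hneg
      nlinarith
    linarith
  have ha0 := norm_nonneg a
  have hin : inner ℝ (a - b) (a + b) = ‖a‖ ^ 2 - ‖b‖ ^ 2 := by
    rw [inner_sub_left, inner_add_right, inner_add_right, real_inner_self_eq_norm_sq,
      real_inner_self_eq_norm_sq, real_inner_comm b a]
    ring
  have h1 : ‖b‖ - ‖a‖ ≤ ‖a - b‖ := by
    rw [norm_sub_rev]
    exact norm_sub_norm_le b a
  have h2 : ‖b‖ - ‖a‖ ≤ ‖a + b‖ := by
    have := norm_sub_norm_le b (-a)
    rw [norm_neg, sub_neg_eq_add, add_comm b a] at this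
    exact this
  have h3 : ‖a - b‖ ≤ ‖a‖ + ‖b‖ := norm_sub_le a b
  have h4 : ‖a + b‖ ≤ ‖a‖ + ‖b‖ := norm_add_le a b
  have hpos1 : 0 < ‖a - b‖ := by linarith
  have hpos2 : 0 < ‖a + b‖ := by linarith
  rw [cosSq, hin, lt_div_iff₀ (by positivity)]
  have h5 : ‖a - b‖ ^ 2 * ‖a + b‖ ^ 2 ≤ (‖a‖ + ‖b‖) ^ 2 * (‖a‖ + ‖b‖) ^ 2 := by gcongr
  have h6 : (1 - η) * (‖a‖ + ‖b‖) ^ 2 < (‖b‖ - ‖a‖) ^ 2 := by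
    have : 4 * ‖a‖ * ‖b‖ < η * (‖a‖ + ‖b‖) ^ 2 := by
      have e1 : 4 * ‖a‖ * ‖b‖ ≤ 4 * ‖b‖ := by nlinarith
      have e2 : 5 * ‖b‖ ≤ η * ‖b‖ ^ 2 := by nlinarith
      have e3 : η * ‖b‖ ^ 2 ≤ η * (‖a‖ + ‖b‖) ^ 2 := by
        gcongr
        linarith
      linarith
    nlinarith
  calc (1 - η) * (‖a - b‖ ^ 2 * ‖a + b‖ ^ 2)
      ≤ (1 - η) * ((‖a‖ + ‖b‖) ^ 2 * (‖a‖ + ‖b‖) ^ 2) :=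
        mul_le_mul_of_nonneg_left h5 (by linarith)
    _ = ((1 - η) * (‖a‖ + ‖b‖) ^ 2) * (‖a‖ + ‖b‖) ^ 2 := by ring
    _ < (‖b‖ - ‖a‖) ^ 2 * (‖a‖ + ‖b‖) ^ 2 := mul_lt_mul_of_pos_right h6 (by positivity)
    _ = _ := by ring

/-- P is a mixture: 1 - δ uniform, and δ spread over a thin double cone about ξ - 2y₀. If y is near
y₀ and z far away, then y - z falls in that cone, where P is huge. -/
lemma exists_angularDensity_of_far {φ : Plane → ℝ} (hd : Differentiable ℝ φ)
    (hc : ConvexOn ℝ univ φ) (y₀ : Plane) {δ : ℝ} (hδ : 0 < δ) (hδ1 : δ < 1) {c : ℝ}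
    (hc0 : 0 < c) :
    ∃ P, IsAngularDensity P ∧ (∀ p, (pairDensity φ P p)⁻¹ ≤ Real.pi / 2 / (1 - δ)) ∧
      ∃ R, ∀ y ∈ Metric.ball y₀ 1, ∀ z ∉ Metric.ball y₀ R, (pairDensity φ P (y, z))⁻¹ ≤ c := by
  have hpi := Real.pi_pos
  -- In the cone the pair density is at least 4δ/I, so I < 4δc makes its inverse at most c.
  obtain ⟨η, hη, hη1, hIlt⟩ := exists_coneAngle_lt (show 0 < 4 * δ * c by positivity)
  set I := coneAngle η with hI
  have hI0 : 0 < I := coneAngle_pos hη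
  -- The axis at ξ = 2y₀ is an arbitrary nonzero vector, so that P is normalized for every ξ.
  set e : Plane → Plane := fun ξ =>
    if ξ = (2 : ℝ) • y₀ then EuclideanSpace.single 0 1 else ξ - (2 : ℝ) • y₀ with he
  have he0 : ∀ ξ, e ξ ≠ 0 := fun ξ => by
    by_cases hξ : ξ = (2 : ℝ) • y₀
    · simp [he, hξ]
    · simp [he, hξ, sub_eq_zero]
  have hem : Measurable e :=
    Measurable.ite (measurableSet_singleton _) measurable_const (by fun_prop)
  set P : Plane → Plane → ℝ := fun ξ w => (1 - δ) / (2 * Real.pi) +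
    δ / I * {u : ℝ | 1 - η < u}.indicator (1 : ℝ → ℝ) (cosSq (e ξ) w) with hP
  have hind : ∀ u, 0 ≤ {u : ℝ | 1 - η < u}.indicator (1 : ℝ → ℝ) u := fun u =>
    indicator_nonneg (fun _ _ => zero_le_one) u
  have hPle : ∀ ξ w, (1 - δ) / (2 * Real.pi) ≤ P ξ w := fun ξ w =>
    le_add_of_nonneg_right (mul_nonneg (by positivity) (hind _))
  have hPdens : IsAngularDensity P := by
    refine ⟨?_, ⟨(1 - δ) / (2 * Real.pi), div_pos (by linarith) (by positivity), hPle⟩,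
      fun ξ w r hr => ?_, fun ξ => ?_⟩
    · have h1 : Measurable fun p : Plane × Plane => cosSq (e p.1) p.2 := by
        unfold cosSq
        have hfst : Measurable fun p : Plane × Plane => e p.1 := hem.comp measurable_fst
        have hsnd : Measurable fun p : Plane × Plane => p.2 := measurable_snd
        exact ((hsnd.inner hfst).pow_const 2).div
          ((hsnd.norm.pow_const 2).mul (hfst.norm.pow_const 2))
      have h2 : Measurable ({u : ℝ | 1 - η < u}.indicator (1 : ℝ → ℝ)) :=
        measurable_one.indicator measurableSet_Ioi
      exact ((h2.comp h1).const_mul _).const_add _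
    · have : cosSq (e ξ) (r • w) = cosSq (e ξ) w := by
        rw [cosSq, cosSq, real_inner_smul_left, norm_smul, Real.norm_of_nonneg hr.le, mul_pow,
          mul_pow, mul_assoc, mul_div_mul_left _ _ (pow_pos hr 2).ne']
      simp only [hP, this]
    · obtain ⟨θ₀, hθ₀⟩ := exists_cosSq_dir_eq (he0 ξ)
      have hPθ : (fun θ => P ξ (dir θ)) = fun θ => (1 - δ) / (2 * Real.pi) +
          δ / I * {θ : ℝ | 1 - η < Real.cos θ ^ 2}.indicator (1 : ℝ → ℝ) (θ - θ₀) := by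
        ext θ
        simp [hP, hθ₀, indicator]
      have hint := (intervalIntegrable_cone η θ₀ (-Real.pi) Real.pi).const_mul (δ / I)
      have hintP : IntervalIntegrable (fun θ => P ξ (dir θ)) volume (-Real.pi) Real.pi := by
        rw [hPθ]
        exact intervalIntegrable_const.add hint
      rw [lintegral_Ioo_eq_integral (fun θ => le_trans
        (div_nonneg (by linarith) (by positivity)) (hPle ξ (dir θ))) hintP, hPθ,
        intervalIntegral.integral_add intervalIntegrable_const hint,
        intervalIntegral.integral_const_mul, integral_cone_sub, intervalIntegral.integral_const]
      have : (Real.pi - -Real.pi) • ((1 - δ) / (2 * Real.pi)) + δ / I * coneAngle η = 1 := by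
        rw [← hI, smul_eq_mul]
        field_simp
        ring
      rw [this, ENNReal.ofReal_one]
  refine ⟨P, hPdens, fun p => ?_, 5 / η, fun y hy z hz => ?_⟩
  · have h1 : 4 * ((1 - δ) / (2 * Real.pi)) ≤ pairDensity φ P p :=
      mul_le_mul (four_le_jac hd hc _ _) (hPle (p.1 + p.2) _)
        (div_nonneg (by linarith) (by positivity)) (by linarith [four_le_jac hd hc p.1 p.2])
    have hδ' : 0 < 1 - δ := by linarith
    refine (inv_anti₀ (by positivity) h1).trans (le_of_eq ?_)
    field_simp
    norm_num
  · set a := y - y₀ with ha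
    set b := z - y₀ with hb
    have ha1 : ‖a‖ < 1 := mem_ball_iff_norm.1 hy
    have hb1 : 5 / η ≤ ‖b‖ := by
      rw [mem_ball_iff_norm] at hz
      exact not_lt.1 hz
    have hab : y + z - (2 : ℝ) • y₀ = a + b := by
      rw [ha, hb]
      module
    have hab' : y - z = a - b := by
      rw [ha, hb]
      module
    have hne : y + z ≠ (2 : ℝ) • y₀ := fun h => by
      have h0 : a + b = 0 := by rw [← hab, h, sub_self]
      have : b = -a := (neg_eq_of_add_eq_zero_right h0).symm
      rw [this, norm_neg] at hb1
      have : 1 ≤ 5 / η := by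
        rw [le_div_iff₀ hη]
        linarith
      linarith
    have hee : e (y + z) = a + b := by simp only [he, if_neg hne, hab]
    have hmem : cosSq (e (y + z)) (y - z) ∈ {u : ℝ | 1 - η < u} := by
      rw [hee, hab']
      exact lt_cosSq_add_sub hη hη1 ha1 hb1
    have hPge : δ / I ≤ P (y + z) (y - z) := by
      simp only [hP]
      rw [indicator_of_mem hmem, Pi.one_apply, mul_one]
      exact le_add_of_nonneg_left (div_nonneg (by linarith) (by positivity))
    have h1 : 4 * (δ / I) ≤ pairDensity φ P (y, z) :=
      mul_le_mul (four_le_jac hd hc _ _) hPge (by positivity)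
        (by linarith [four_le_jac hd hc y z])
    refine (inv_anti₀ (by positivity) h1).trans ?_
    rw [← mul_div_assoc, inv_div, div_le_iff₀ (by positivity)]
    linarith

/-! ### Mass distribution of extremizing sequences -/

/-- The measure with density `|f|²`. -/
noncomputable def massMeasure (f : L2Plane) : Measure Plane :=
  volume.withDensity fun y => ‖f y‖ₑ ^ 2

lemma measurable_enorm_sq (f : L2Plane) : Measurable fun y => ‖f y‖ₑ ^ 2 :=
  ((Lp.stronglyMeasurable f).measurable.enorm).pow_const 2

lemma massMeasure_univ (f : L2Plane) : massMeasure f univ = ‖f‖ₑ ^ 2 := by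
  have h1 := eLpNorm_nnreal_pow_eq_lintegral (f := f) (p := 2) (μ := volume) two_ne_zero
  have h2 : eLpNorm f 2 volume ^ 2 = ∫⁻ y, ‖f y‖ₑ ^ 2 := by simpa using h1
  rw [massMeasure, withDensity_apply _ MeasurableSet.univ, Measure.restrict_univ, ← h2,
    Lp.enorm_def]

instance (f : L2Plane) : IsFiniteMeasure (massMeasure f) :=
  ⟨by rw [massMeasure_univ]; exact ENNReal.pow_lt_top (by simp)⟩

lemma massMeasure_real_univ (f : L2Plane) : (massMeasure f).real univ = ‖f‖ ^ 2 := by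
  rw [Measure.real, massMeasure_univ, ENNReal.toReal_pow, toReal_enorm]

lemma massMeasure_real_univ_le_one {f : L2Plane} (hf : ‖f‖ ≤ 1) :
    (massMeasure f).real univ ≤ 1 := by
  rw [massMeasure_real_univ]
  exact pow_le_one₀ (norm_nonneg _) hf

lemma setIntegral_norm_sq_eq (f : L2Plane) {S : Set Plane} (hS : MeasurableSet S) :
    ∫ y in S, ‖f y‖ ^ 2 = (massMeasure f).real S := by
  have hm : StronglyMeasurable fun y => ‖f y‖ ^ 2 := (Lp.stronglyMeasurable f).norm.pow 2
  rw [Measure.real, massMeasure, withDensity_apply _ hS,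
    integral_eq_lintegral_of_nonneg_ae (Eventually.of_forall fun y => by positivity)
      hm.aestronglyMeasurable]
  congr 1
  refine lintegral_congr fun y => ?_
  rw [ENNReal.ofReal_pow (norm_nonneg _), ofReal_norm]

lemma selfConvNorm_sq_le_of_bounds {φ : Plane → ℝ} (h : ContDiff ℝ 1 φ) (hc : ConvexOn ℝ univ φ)
    {P : Plane → Plane → ℝ} (hP : IsAngularDensity P) {M c : ℝ} (hc0 : 0 ≤ c)
    (hcM : c ≤ M) {E : Set (Plane × Plane)} (hE : MeasurableSet E)
    (hM : ∀ p, (pairDensity φ P p)⁻¹ ≤ M) (hcE : ∀ p ∈ E, (pairDensity φ P p)⁻¹ ≤ c)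
    (f : L2Plane) :
    selfConvNorm φ f ^ 2 ≤ ENNReal.ofReal (M * (massMeasure f).real univ ^ 2 -
      (M - c) * ((massMeasure f).prod (massMeasure f)).real E) := by
  set μ := massMeasure f with hμ
  have hfm := (Lp.stronglyMeasurable f).measurable
  have hprod : μ.prod μ = (volume : Measure (Plane × Plane)).withDensity
      fun p => ‖f p.1‖ₑ ^ 2 * ‖f p.2‖ₑ ^ 2 := by
    rw [hμ, massMeasure, prod_withDensity (measurable_enorm_sq f) (measurable_enorm_sq f),
      Measure.volume_eq_prod]
  have hW : Measurable fun p => ENNReal.ofReal (pairDensity φ P p)⁻¹ :=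
    (measurable_pairDensity h hP).inv.ennreal_ofReal
  have h1 : ∫⁻ p : Plane × Plane, ENNReal.ofReal (pairDensity φ P p)⁻¹ *
      (‖f p.1‖ₑ * ‖f p.2‖ₑ) ^ 2 = ∫⁻ p, ENNReal.ofReal (pairDensity φ P p)⁻¹ ∂(μ.prod μ) := by
    rw [hprod, lintegral_withDensity_eq_lintegral_mul _ (by fun_prop) hW]
    refine lintegral_congr fun p => ?_
    rw [Pi.mul_apply, mul_pow, mul_comm]
  refine (selfConvNorm_sq_le h hc hP hfm (Lp.memLp f)).trans ?_
  rw [h1, ← lintegral_add_compl _ hE]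
  have hE1 : ∫⁻ p in E, ENNReal.ofReal (pairDensity φ P p)⁻¹ ∂(μ.prod μ) ≤
      ENNReal.ofReal (c * (μ.prod μ).real E) := by
    calc _ ≤ ∫⁻ p in E, ENNReal.ofReal c ∂(μ.prod μ) :=
          setLIntegral_mono measurable_const fun p hp => ENNReal.ofReal_le_ofReal (hcE p hp)
      _ = _ := by
        rw [setLIntegral_const, ENNReal.ofReal_mul hc0, ofReal_measureReal]
  have hE2 : ∫⁻ p in Eᶜ, ENNReal.ofReal (pairDensity φ P p)⁻¹ ∂(μ.prod μ) ≤
      ENNReal.ofReal (M * (μ.prod μ).real Eᶜ) := by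
    calc _ ≤ ∫⁻ p in Eᶜ, ENNReal.ofReal M ∂(μ.prod μ) :=
          setLIntegral_mono measurable_const fun p _ => ENNReal.ofReal_le_ofReal (hM p)
      _ = _ := by
        rw [setLIntegral_const, ENNReal.ofReal_mul (hc0.trans hcM), ofReal_measureReal]
  refine (add_le_add hE1 hE2).trans ?_
  rw [← ENNReal.ofReal_add (by positivity) (mul_nonneg (hc0.trans hcM) measureReal_nonneg)]
  refine ENNReal.ofReal_le_ofReal (le_of_eq ?_)
  have huniv : (μ.prod μ).real univ = μ.real univ ^ 2 := by
    rw [← univ_prod_univ, measureReal_prod_prod, sq]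
  rw [measureReal_compl hE, huniv]
  ring

section Extremizing

variable {φ : Plane → ℝ} {f : ℕ → L2Plane}

lemma eventually_lt_selfConvNorm_sq (hopt : ENNReal.ofReal (Real.pi / 2) ≤ optConst φ ^ 4)
    (hf : IsExtremizingSeq φ f) {ε : ℝ} (hε : 0 < ε) :
    ∀ᶠ n in atTop, ENNReal.ofReal (Real.pi / 2 - ε) < selfConvNorm φ (f n) ^ 2 := by
  have hlim : Tendsto (fun n => selfConvNorm φ (f n) ^ 2) atTop (𝓝 (optConst φ ^ 4)) := by
    have := ((ENNReal.continuous_pow 2).tendsto _).comp hf.2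
    rw [← pow_mul] at this
    exact this
  refine hlim.eventually_const_lt (lt_of_lt_of_le ?_ hopt)
  rw [ENNReal.ofReal_lt_ofReal_iff (by positivity)]
  linarith

/-- The mechanism for all mass estimates: pairs in E gain M - c relative to the global weight bound
M, yet the total must stay near π/2. -/
lemma eventually_mul_prod_real_lt (h : ContDiff ℝ 1 φ) (hc : ConvexOn ℝ univ φ)
    (hopt : ENNReal.ofReal (Real.pi / 2) ≤ optConst φ ^ 4) (hf : IsExtremizingSeq φ f)
    {P : Plane → Plane → ℝ} (hP : IsAngularDensity P) {M c : ℝ} (hc0 : 0 ≤ c)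
    (hcM : c ≤ M) {E : Set (Plane × Plane)} (hE : MeasurableSet E)
    (hM : ∀ p, (pairDensity φ P p)⁻¹ ≤ M) (hcE : ∀ p ∈ E, (pairDensity φ P p)⁻¹ ≤ c)
    {ε : ℝ} (hε : 0 < ε) :
    ∀ᶠ n in atTop, Real.pi / 2 - ε < M * (massMeasure (f n)).real univ ^ 2 - (M - c) *
      ((massMeasure (f n)).prod (massMeasure (f n))).real E := by
  -- It suffices to treat `ε ≤ 1`, so that the left-hand side is positive.
  have hmin : 0 < min ε 1 := lt_min hε one_pos
  filter_upwards [eventually_lt_selfConvNorm_sq hopt hf hmin] with n hn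
  have h1 := hn.trans_le (selfConvNorm_sq_le_of_bounds h hc hP hc0 hcM hE hM hcE (f n))
  have h2 := (ENNReal.ofReal_lt_ofReal_iff_of_nonneg
    (by linarith [min_le_right ε 1, Real.pi_gt_three])).1 h1
  linarith [min_le_left ε 1]

lemma inv_pairDensity_const_le (h : ContDiff ℝ 1 φ) (hc : ConvexOn ℝ univ φ) (p : Plane × Plane) :
    (pairDensity φ (fun _ _ => (2 * Real.pi)⁻¹) p)⁻¹ ≤ Real.pi / 2 := by
  have hj := four_le_jac (h.differentiable one_ne_zero) hc p.1 p.2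
  unfold pairDensity
  rw [mul_inv, inv_inv, inv_mul_eq_div, div_le_div_iff₀ (by linarith) two_pos]
  nlinarith [Real.pi_pos]

lemma eventually_lt_mass_univ (h : ContDiff ℝ 1 φ) (hc : ConvexOn ℝ univ φ)
    (hopt : ENNReal.ofReal (Real.pi / 2) ≤ optConst φ ^ 4) (hf : IsExtremizingSeq φ f)
    {κ : ℝ} (hκ : 0 < κ) : ∀ᶠ n in atTop, 1 - κ < (massMeasure (f n)).real univ := by
  filter_upwards [eventually_mul_prod_real_lt h hc hopt hf isAngularDensity_const
    (M := Real.pi / 2) (by positivity) le_rfl MeasurableSet.empty (inv_pairDensity_const_le h hc)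
    (by simp) (show 0 < Real.pi / 2 * κ by positivity)] with n hn
  have h1 := massMeasure_real_univ_le_one (hf.1 n)
  have h0 : 0 ≤ (massMeasure (f n)).real univ := measureReal_nonneg
  simp only [measureReal_empty, mul_zero, sub_zero] at hn
  have h2 : Real.pi / 2 * (1 - κ) < Real.pi / 2 * (massMeasure (f n)).real univ ^ 2 := by linarith
  have h3 := lt_of_mul_lt_mul_left h2 (by positivity)
  nlinarith

lemma eventually_prod_separated_lt (h : ContDiff ℝ 1 φ) (hc : StrictConvexOn ℝ univ φ)
    (hopt : ENNReal.ofReal (Real.pi / 2) ≤ optConst φ ^ 4) (hf : IsExtremizingSeq φ f)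
    (R : ℝ) {ρ κ : ℝ} (hρ : 0 < ρ) (hκ : 0 < κ) :
    ∀ᶠ n in atTop, ((massMeasure (f n)).prod (massMeasure (f n))).real
      {p | ‖p.1‖ ≤ R ∧ ‖p.2‖ ≤ R ∧ ρ ≤ ‖p.1 - p.2‖} < κ := by
  obtain ⟨c, hc2, hcE⟩ := exists_inv_pairDensity_lt_of_separated h hc R hρ
  have hE : MeasurableSet {p : Plane × Plane | ‖p.1‖ ≤ R ∧ ‖p.2‖ ≤ R ∧ ρ ≤ ‖p.1 - p.2‖} := by
    refine ((isClosed_le (f := fun p : Plane × Plane => ‖p.1‖) (g := fun _ => R) (by fun_prop)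
      (by fun_prop)).inter ((isClosed_le (f := fun p : Plane × Plane => ‖p.2‖) (g := fun _ => R)
      (by fun_prop) (by fun_prop)).inter (isClosed_le (f := fun _ => ρ)
        (g := fun p : Plane × Plane => ‖p.1 - p.2‖) (by fun_prop) (by fun_prop)))).measurableSet
  have hmax : max c 0 < Real.pi / 2 := max_lt hc2 (by positivity)
  have hgap : 0 < Real.pi / 2 - max c 0 := by linarith
  filter_upwards [eventually_mul_prod_real_lt h hc.convexOn hopt hf isAngularDensity_const
    (M := Real.pi / 2) (le_max_right c 0) hmax.le hE (inv_pairDensity_const_le h hc.convexOn)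
    (fun p hp => (hcE p hp.1 hp.2.1 hp.2.2).trans (le_max_left c 0))
    (show 0 < (Real.pi / 2 - max c 0) * κ by positivity)] with n hn
  have h1 := massMeasure_real_univ_le_one (hf.1 n)
  have h0 : 0 ≤ (massMeasure (f n)).real univ := measureReal_nonneg
  have h2 : (massMeasure (f n)).real univ ^ 2 ≤ 1 := pow_le_one₀ h0 h1
  have h3 : Real.pi / 2 * (massMeasure (f n)).real univ ^ 2 ≤ Real.pi / 2 :=
    mul_le_of_le_one_right (by positivity) h2
  exact lt_of_mul_lt_mul_left (by linarith) hgap.le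

lemma exists_eventually_mul_mass_lt (h : ContDiff ℝ 1 φ) (hc : ConvexOn ℝ univ φ)
    (hopt : ENNReal.ofReal (Real.pi / 2) ≤ optConst φ ^ 4) (hf : IsExtremizingSeq φ f)
    (y₀ : Plane) {κ : ℝ} (hκ : 0 < κ) :
    ∃ R, ∀ᶠ n in atTop, (massMeasure (f n)).real (Metric.ball y₀ 1) *
      (massMeasure (f n)).real (Metric.ball y₀ R)ᶜ < κ := by
  have hpi := Real.pi_gt_three
  -- Chosen so that the global weight bound (π/2)/(1 - δ) equals π/2 + κ/4.
  set δ := κ / (κ + 2 * Real.pi) with hδ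
  have hδ0 : 0 < δ := by positivity
  have hδ1 : 1 - δ = 2 * Real.pi / (κ + 2 * Real.pi) := by
    rw [hδ]
    field_simp
    ring
  have hM : Real.pi / 2 / (1 - δ) = Real.pi / 2 + κ / 4 := by
    rw [hδ1]
    field_simp
    ring
  have hδ' : 0 < 1 - δ := by rw [hδ1]; positivity
  obtain ⟨P, hP, hPM, R, hR⟩ := exists_angularDensity_of_far (h.differentiable one_ne_zero) hc y₀
    hδ0 (by linarith) (c := 1 / 2) (by norm_num)
  rw [hM] at hPM
  refine ⟨R, ?_⟩
  filter_upwards [eventually_mul_prod_real_lt h hc hopt hf hP (c := 1 / 2) (by norm_num)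
    (by linarith) (measurableSet_ball.prod measurableSet_ball.compl) hPM
    (fun p hp => hR p.1 hp.1 p.2 hp.2) (show 0 < κ / 4 by positivity)] with n hn
  rw [measureReal_prod_prod] at hn
  set m := (massMeasure (f n)).real (Metric.ball y₀ 1) *
    (massMeasure (f n)).real (Metric.ball y₀ R)ᶜ
  have hm0 : 0 ≤ m := mul_nonneg measureReal_nonneg measureReal_nonneg
  have h1 := massMeasure_real_univ_le_one (hf.1 n)
  have h0 : 0 ≤ (massMeasure (f n)).real univ := measureReal_nonneg
  have h2 : (massMeasure (f n)).real univ ^ 2 ≤ 1 := pow_le_one₀ h0 h1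
  have h3 : (Real.pi / 2 + κ / 4) * (massMeasure (f n)).real univ ^ 2 ≤ Real.pi / 2 + κ / 4 :=
    mul_le_of_le_one_right (by positivity) h2
  -- The coefficient is at least 1 because π > 3, which is why c = 1/2 suffices.
  have h4 : m ≤ (Real.pi / 2 + κ / 4 - 1 / 2) * m := le_mul_of_one_le_left hm0 (by linarith)
  linarith

lemma exists_eventually_mass_sq_lt (h : ContDiff ℝ 2 φ) (hc : ConvexOn ℝ univ φ)
    (hopt : ENNReal.ofReal (Real.pi / 2) ≤ optConst φ ^ 4) (hf : IsExtremizingSeq φ f)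
    {y₀ : Plane} (h0 : hessian φ y₀ ≠ 0) :
    ∃ ρ > 0, ∃ q < 1, ∀ᶠ n in atTop, (massMeasure (f n)).real (Metric.ball y₀ ρ) ^ 2 < q := by
  obtain ⟨P, hP, M, hM, ρ, hρ, c, hc2, hcE⟩ := exists_angularDensity_of_hessian_ne_zero h hc h0
  have hmax : max c 0 < Real.pi / 2 := max_lt hc2 (by positivity)
  set c' := max c 0
  set M' := max M (Real.pi / 2)
  have hM' : Real.pi / 2 ≤ M' := le_max_right _ _
  -- Half the local gain: the resulting bound on the squared mass is then strictly below 1.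
  set ε := (Real.pi / 2 - c') / 2 with hε
  have hε0 : 0 < ε := by rw [hε]; linarith
  refine ⟨ρ, hρ, (M' - Real.pi / 2 + ε) / (M' - c'), ?_, ?_⟩
  · rw [div_lt_one (by linarith)]
    linarith
  · filter_upwards [eventually_mul_prod_real_lt (h.of_le one_le_two) hc hopt hf hP
      (le_max_right c 0) (hmax.le.trans hM') (measurableSet_ball.prod measurableSet_ball)
      (fun p => (hM p).trans (le_max_left _ _))
      (fun p hp => (hcE p.1 hp.1 p.2 hp.2).trans (le_max_left c 0)) hε0] with n hn
    rw [measureReal_prod_prod] at hn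
    have h1 := massMeasure_real_univ_le_one (hf.1 n)
    have h0 : 0 ≤ (massMeasure (f n)).real univ := measureReal_nonneg
    have h2 : (massMeasure (f n)).real univ ^ 2 ≤ 1 := pow_le_one₀ h0 h1
    have h3 : M' * (massMeasure (f n)).real univ ^ 2 ≤ M' :=
      mul_le_of_le_one_right (by linarith [Real.pi_pos]) h2
    rw [lt_div_iff₀ (by linarith), sq]
    linarith

end Extremizing

/-! ### Concentration -/

/-- Fubini and averaging: if every section over B were larger than c, the product measure of E would
be at least cδ. -/
lemma exists_section_le {μ : Measure Plane} [IsFiniteMeasure μ] {E : Set (Plane × Plane)}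
    (hE : MeasurableSet E) {B : Set Plane} {c δ : ℝ} (hc : 0 < c)
    (hBδ : δ ≤ μ.real B) (hEc : (μ.prod μ).real E < c * δ) :
    ∃ x ∈ B, μ.real (Prod.mk x ⁻¹' E) ≤ c := by
  by_contra! hcon
  have h1 : ENNReal.ofReal (c * δ) ≤ (μ.prod μ) E := by
    calc ENNReal.ofReal (c * δ) ≤ ENNReal.ofReal (c * μ.real B) := by gcongr
      _ = ∫⁻ _ in B, ENNReal.ofReal c ∂μ := by
        rw [setLIntegral_const, ENNReal.ofReal_mul hc.le, ofReal_measureReal]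
      _ ≤ ∫⁻ x in B, μ (Prod.mk x ⁻¹' E) ∂μ := by
        refine setLIntegral_mono (measurable_measure_prodMk_left hE) fun x hx => ?_
        rw [← ofReal_measureReal]
        exact ENNReal.ofReal_le_ofReal (hcon x hx).le
      _ ≤ ∫⁻ x, μ (Prod.mk x ⁻¹' E) ∂μ := setLIntegral_le_lintegral _ _
      _ = _ := (Measure.prod_apply hE).symm
  rw [← ofReal_measureReal, ENNReal.ofReal_le_ofReal_iff measureReal_nonneg] at h1
  linarith

lemma concentratesAt_of_mass {f : ℕ → L2Plane} {y₀ : Plane}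
    (huniv : ∀ᶠ n in atTop, 1 / 2 ≤ (massMeasure (f n)).real univ)
    (h : ∀ ρ > 0, ∀ κ > 0, ∀ᶠ n in atTop, (massMeasure (f n)).real {y | ρ ≤ ‖y - y₀‖} < κ) :
    ConcentratesAt f y₀ := by
  intro ε hε ρ hρ
  obtain ⟨N, hN⟩ := eventually_atTop.1 (huniv.and (h ρ hρ (ε / 2) (by positivity)))
  refine ⟨N, fun n hn => ?_⟩
  obtain ⟨h1, h2⟩ := hN n hn
  rw [setIntegral_norm_sq_eq _ (isClosed_le continuous_const (by fun_prop)).measurableSet,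
    ← massMeasure_real_univ]
  nlinarith

lemma exists_subseq_concentratesAtInfinity {f : ℕ → L2Plane}
    (huniv : ∀ᶠ n in atTop, 1 / 2 ≤ (massMeasure (f n)).real univ)
    (h : ∀ R δ : ℝ, 0 < δ → ∃ᶠ n in atTop, (massMeasure (f n)).real (Metric.closedBall 0 R) < δ) :
    ∃ k : ℕ → ℕ, StrictMono k ∧ ConcentratesAtInfinity fun n => f (k n) := by
  obtain ⟨k, hk, hkP⟩ := extraction_forall_of_frequently (fun j : ℕ =>
    (h j (1 / ((j : ℝ) + 1)) (by positivity)).and_eventually huniv)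
  refine ⟨k, hk, fun ε hε ρ hρ => ?_⟩
  obtain ⟨N₁, hN₁⟩ := exists_nat_ge ρ
  obtain ⟨N₂, hN₂⟩ := exists_nat_one_div_lt (half_pos hε)
  refine ⟨max N₁ N₂, fun n hn => ?_⟩
  obtain ⟨h1, h2⟩ := hkP n
  have hn1 : (N₁ : ℝ) ≤ n := by exact_mod_cast (le_max_left _ _).trans hn
  have hn2 : (N₂ : ℝ) ≤ n := by exact_mod_cast (le_max_right _ _).trans hn
  have h3 : 1 / ((n : ℝ) + 1) ≤ 1 / ((N₂ : ℝ) + 1) := by gcongr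
  rw [setIntegral_norm_sq_eq _ (isClosed_le (by fun_prop) continuous_const).measurableSet,
    ← massMeasure_real_univ]
  have h4 : (massMeasure (f (k n))).real {y | ‖y‖ ≤ ρ} ≤
      (massMeasure (f (k n))).real (Metric.closedBall 0 n) := by
    refine measureReal_mono fun y hy => ?_
    rw [mem_closedBall_zero_iff]
    exact le_trans hy (hN₁.trans hn1)
  nlinarith

/-- An extremizing sequence which retains mass in a ball has a subsequence which, in any fixed
ball, concentrates at a single point. -/
lemma exists_subseq_local_concentration {φ : Plane → ℝ} {f : ℕ → L2Plane} (h : ContDiff ℝ 1 φ)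
    (hc : StrictConvexOn ℝ univ φ) (hopt : ENNReal.ofReal (Real.pi / 2) ≤ optConst φ ^ 4)
    (hf : IsExtremizingSeq φ f) {R₀ δ : ℝ} (hδ : 0 < δ)
    (hmass : ∀ᶠ n in atTop, δ ≤ (massMeasure (f n)).real (Metric.closedBall 0 R₀)) :
    ∃ k : ℕ → ℕ, StrictMono k ∧ ∃ y₀, ∀ R : ℝ, ∀ ρ > 0, ∀ κ > 0, ∀ᶠ n in atTop,
      (massMeasure (f (k n))).real {y | ‖y‖ ≤ R ∧ ρ ≤ ‖y - y₀‖} < κ := by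
  set E : ℕ → Set (Plane × Plane) := fun j =>
    {p | ‖p.1‖ ≤ R₀ + j ∧ ‖p.2‖ ≤ R₀ + j ∧ 1 / ((j : ℝ) + 1) ≤ ‖p.1 - p.2‖} with hEdef
  have hE : ∀ j, MeasurableSet (E j) := fun j =>
    ((isClosed_le (f := fun p : Plane × Plane => ‖p.1‖) (g := fun _ => R₀ + j) (by fun_prop)
      (by fun_prop)).inter ((isClosed_le (f := fun p : Plane × Plane => ‖p.2‖)
      (g := fun _ => R₀ + j) (by fun_prop) (by fun_prop)).inter
        (isClosed_le (f := fun _ => 1 / ((j : ℝ) + 1))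
        (g := fun p : Plane × Plane => ‖p.1 - p.2‖) (by fun_prop) (by fun_prop)))).measurableSet
  -- Diagonal choice: at stage j the radius grows and the separation shrinks. The factor δ in the
  -- threshold makes some section over the ball have mass at most 1/(j + 1).
  obtain ⟨k, hk, hkP⟩ := extraction_forall_of_eventually (fun j : ℕ =>
    (eventually_prod_separated_lt h hc hopt hf (R₀ + j) (ρ := 1 / ((j : ℝ) + 1))
      (κ := 1 / ((j : ℝ) + 1) * δ) (by positivity) (by positivity)).and hmass)
  have hx : ∀ j, ∃ x ∈ Metric.closedBall (0 : Plane) R₀,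
      (massMeasure (f (k j))).real (Prod.mk x ⁻¹' E j) ≤ 1 / ((j : ℝ) + 1) := fun j =>
    exists_section_le (hE j) (by positivity) (hkP j).2 (hkP j).1
  choose x hxB hxE using hx
  obtain ⟨y₀, -, l, hl, hlim⟩ := (isCompact_closedBall (0 : Plane) R₀).tendsto_subseq hxB
  refine ⟨k ∘ l, hk.comp hl, y₀, fun R ρ hρ κ hκ => ?_⟩
  have hlt : Tendsto (fun n => ((l n : ℕ) : ℝ)) atTop atTop :=
    tendsto_natCast_atTop_atTop.comp hl.tendsto_atTop
  have hinv : Tendsto (fun n => 1 / (((l n : ℕ) : ℝ) + 1)) atTop (𝓝 0) :=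
    tendsto_one_div_add_atTop_nhds_zero_nat.comp hl.tendsto_atTop
  filter_upwards [hlt.eventually_ge_atTop (R - R₀), hinv.eventually_lt_const hκ,
    hinv.eventually_lt_const (half_pos hρ), Metric.tendsto_nhds.1 hlim (ρ / 2) (half_pos hρ)]
    with n h1 h2 h3 h4
  refine (measureReal_mono ?_).trans_lt ((hxE (l n)).trans_lt h2)
  rintro y ⟨hyR, hyρ⟩
  rw [Function.comp_apply, dist_eq_norm] at h4
  refine ⟨?_, ?_, ?_⟩
  · have := mem_closedBall_zero_iff.1 (hxB (l n))
    have hn0 : (0 : ℝ) ≤ (l n : ℕ) := Nat.cast_nonneg _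
    show ‖x (l n)‖ ≤ R₀ + (l n : ℕ)
    linarith
  · show ‖y‖ ≤ R₀ + (l n : ℕ)
    linarith
  · show 1 / (((l n : ℕ) : ℝ) + 1) ≤ ‖x (l n) - y‖
    have h5 : y - y₀ = (x (l n) - y₀) - (x (l n) - y) := by module
    have h6 := norm_sub_le (x (l n) - y₀) (x (l n) - y)
    rw [← h5] at h6
    linarith

end PerturbedParaboloid

/-! ### The dichotomy between concentration at a point and escape to infinity. -/

open PerturbedParaboloid in
theorem theorem1p4 (φ : PerturbedParaboloid.Plane → ℝ)
    (hnonneg : ∀ y, 0 ≤ φ y)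
    (hC2 : ContDiff ℝ 2 φ)
    (hconv : StrictConvexOn ℝ Set.univ φ)
    (hHess : (∃ y₀, PerturbedParaboloid.hessian φ y₀ = 0) ∨
      ∃ y : ℕ → PerturbedParaboloid.Plane,
        Tendsto (fun n => ‖y n‖) atTop atTop ∧
        Tendsto (fun n => PerturbedParaboloid.hessian φ (y n)) atTop (𝓝 0))
    (f : ℕ → PerturbedParaboloid.L2Plane)
    (hf : PerturbedParaboloid.IsExtremizingSeq φ f) :
    ∃ k : ℕ → ℕ, StrictMono k ∧
      ((∃ y₀, PerturbedParaboloid.hessian φ y₀ = 0 ∧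
          PerturbedParaboloid.ConcentratesAt (fun n => f (k n)) y₀) ∨
        PerturbedParaboloid.ConcentratesAtInfinity (fun n => f (k n))) := by
  have h1 : ContDiff ℝ 1 φ := hC2.of_le one_le_two
  have hc := hconv.convexOn
  have hopt : ENNReal.ofReal (Real.pi / 2) ≤ optConst φ ^ 4 :=
    pi_div_two_le_optConst h1 hc fun ε hε => exists_gradGap_le hC2 hHess hε
  have huniv : ∀ κ > 0, ∀ᶠ n in atTop, 1 - κ < (massMeasure (f n)).real univ := fun κ hκ =>
    eventually_lt_mass_univ h1 hc hopt hf hκ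
  have hhalf : ∀ᶠ n in atTop, 1 / 2 ≤ (massMeasure (f n)).real univ :=
    (huniv (1 / 2) (by norm_num)).mono fun n hn => by linarith
  by_cases hmass : ∃ R₀ δ : ℝ, 0 < δ ∧
      ∀ᶠ n in atTop, δ ≤ (massMeasure (f n)).real (Metric.closedBall 0 R₀)
  · obtain ⟨R₀, δ, hδ, hmass⟩ := hmass
    obtain ⟨k, hk, y₀, hloc⟩ := exists_subseq_local_concentration h1 hconv hopt hf hδ hmass
    have hsmall : ∀ ρ > 0, ∀ κ > 0, ∀ᶠ n in atTop,
        (massMeasure (f (k n))).real {y | ρ ≤ ‖y - y₀‖} < κ := by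
      intro ρ hρ κ hκ
      -- The unit ball about y₀ eventually holds more than δ/2 of the mass, so this product bound
      -- forces the mass outside radius R below κ/2.
      obtain ⟨R, hR⟩ := exists_eventually_mul_mass_lt h1 hc hopt hf y₀
        (show 0 < κ / 2 * (δ / 2) by positivity)
      filter_upwards [hk.tendsto_atTop.eventually hR, hk.tendsto_atTop.eventually hmass,
        hloc R₀ 1 one_pos (δ / 2) (half_pos hδ), hloc (‖y₀‖ + R) ρ hρ (κ / 2) (half_pos hκ)]
        with n hn1 hn2 hn3 hn4
      set μ := massMeasure (f (k n))
      have hball : δ ≤ μ.real (Metric.ball y₀ 1) + μ.real {y | ‖y‖ ≤ R₀ ∧ 1 ≤ ‖y - y₀‖} := by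
        refine hn2.trans ((measureReal_mono fun y hy => ?_).trans (measureReal_union_le _ _))
        by_cases hy1 : y ∈ Metric.ball y₀ 1
        · exact Or.inl hy1
        · refine Or.inr ⟨mem_closedBall_zero_iff.1 hy, ?_⟩
          rwa [mem_ball_iff_norm, not_lt] at hy1
      have hfar : μ.real (Metric.ball y₀ R)ᶜ < κ / 2 := by
        by_contra! hcon
        have : κ / 2 * (δ / 2) ≤ μ.real (Metric.ball y₀ 1) * μ.real (Metric.ball y₀ R)ᶜ := by
          rw [mul_comm (μ.real _)]
          exact mul_le_mul hcon (by linarith) (by positivity) measureReal_nonneg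
        linarith
      have hunion : μ.real {y | ρ ≤ ‖y - y₀‖} ≤
          μ.real (Metric.ball y₀ R)ᶜ + μ.real {y | ‖y‖ ≤ ‖y₀‖ + R ∧ ρ ≤ ‖y - y₀‖} := by
        refine (measureReal_mono fun y hy => ?_).trans (measureReal_union_le _ _)
        by_cases hyR : y ∈ Metric.ball y₀ R
        · refine Or.inr ⟨?_, hy⟩
          rw [mem_ball_iff_norm] at hyR
          have := norm_add_le y₀ (y - y₀)
          rw [add_sub_cancel] at this
          linarith
        · exact Or.inl hyR
      linarith
    refine ⟨k, hk, Or.inl ⟨y₀, ?_, concentratesAt_of_mass (f := fun n => f (k n))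
      (hk.tendsto_atTop.eventually hhalf) hsmall⟩⟩
    by_contra h0
    obtain ⟨ρ, hρ, q, hq, hlt⟩ := exists_eventually_mass_sq_lt hC2 hc hopt hf h0
    -- The ball then has mass m > 1 - (1 - q)/4, and m² ≥ 2m - 1 exceeds q.
    have hκ : 0 < (1 - q) / 8 := by linarith
    obtain ⟨n, hn1, hn2, hn3⟩ := ((hk.tendsto_atTop.eventually hlt).and
      ((hk.tendsto_atTop.eventually (huniv _ hκ)).and (hsmall ρ hρ _ hκ))).exists
    set μ := massMeasure (f (k n))
    have hsplit : μ.real univ ≤ μ.real (Metric.ball y₀ ρ) + μ.real {y | ρ ≤ ‖y - y₀‖} := by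
      refine (measureReal_mono fun y _ => ?_).trans (measureReal_union_le _ _)
      by_cases hyρ : y ∈ Metric.ball y₀ ρ
      · exact Or.inl hyρ
      · refine Or.inr ?_
        rwa [mem_ball_iff_norm, not_lt] at hyρ
    nlinarith [sq_nonneg (μ.real (Metric.ball y₀ ρ) - 1)]
  · push Not at hmass
    obtain ⟨k, hk, hinf⟩ := exists_subseq_concentratesAtInfinity hhalf fun R δ hδ =>
      (hmass R δ hδ).mono fun n hn => hn
    exact ⟨k, hk, Or.inr hinf⟩
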